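/- Throughout, $M$ is a smooth finite-dimensional manifold (Hausdorff, second countable, without boundary). A bivector field is a section $\pi$ of $\Lambda^2TM$, with $\pi^\sharp\colon T^*M\to TM$, $\pi^\sharp(\alpha)=\pi(\alpha,\cdot)$, and $\{f,g\}=\pi(df,dg)$; it is Poisson if $[\pi,\pi]=0$ for the Schouten–Nijenhuis bracket. An almost regular foliation is a $C^\infty(M)$-submodule $E\subset\mathfrak X(M)$ that is closed under the Lie bracket and locally free of some finite rank $k$: every point has a neighbourhood $U$ on which $E$ is generated over $C^\infty(U)$ by $k$ elements that are $C^\infty(U)$-linearly independent. The symplectic foliation of a Poisson manifold $(M,\pi)$ is $\pi^\sharp(\Omega^1(M))$, and $(M,\pi)$ is almost regular if this is an almost regular foliation. An ai-algebroid is a Lie algebroid $A\to M$ whose anchor $\rho\colon A\to TM$ is injective on the fibres over an open dense subset of $M$; it is an ai-algebroid of $E$ if $\rho(\Gamma(A))=E$, and $E$ has full rank if $\operatorname{rank}A=\dim M$. A form $\omega\in\Gamma(\Lambda^2A^*)$ is closed if $d_A\omega=0$, where $d_A$ is given by the Cartan formula, and $E$-symplectic if it is closed and non-degenerate at every point. **Theorem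 A.** (1) Let $E$ be an almost regular foliation with ai-algebroid $(A,\rho)$ and let $\omega$ be an $E$-symplectic form. There is a unique bivector $\pi_\omega\in\Gamma(\Lambda^2A)$ dual to $\omega$, that is, with $\pi_\omega^\sharp=-(\omega^\flat)^{-1}$ for $\omega^\flat(v)=\omega(v,\cdot)$, and $\pi^\sharp:=\rho\circ\pi_\omega^\sharp\circ\rho^*\colon T^*M\to TM$ is the musical morphism of a Poisson bivector field $\pi$ on $M$. If $E$ has full rank, then $(M,\pi)$ is an almost regular Poisson manifold. (2) Let $(M,\pi)$ be an almost regular Poisson manifold with symplectic foliation $E=\pi^\sharp(\Omega^1(M))$ and let $(A,\rho)$ be an ai-algebroid of $E$. There is a unique vector bundle map $\lambda\colon T^*M\to A$ with $\rho\circ\lambda=\pi^\sharp$; it is surjective on every fibre; there is a unique $\omega_\pi\in\Gamma(\Lambda^2A^*)$ with $\omega_\pi(\lambda\alpha,\lambda\beta)=\pi(\alpha,\beta)$ for all covectors $\alpha,\beta$ at the same point; and $\omega_\pi$ is closed, and non-degenerate at every point of an open dense subset of $M$. If $E$ has full rank, then $\lambda$ is bijective on every fibre and is an isomorphism of Lie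 algebroids from the cotangent Lie algebroid $T^*M$ of $\pi$ (anchor $\pi^\sharp$, bracket with $[df,dg]=d\{f,g\}$) onto $A$; under this isomorphism $\omega_\pi$ is identified with $\pi\in\Gamma(\Lambda^2TM)$, regarded as a two-form on the Lie algebroid $T^*M$. -/

import Mathlib

open Set Module Bundle
open scoped Manifold ContDiff Topology

noncomputable section

namespace EStruct

/-! ### Smooth sections, bundle maps, multiplication by functions -/

section Basic

variable {E₀ : Type*} [NormedAddCommGroup E₀] [NormedSpace ℝ E₀]
  {H : Type*} [TopologicalSpace H] (I : ModelWithCorners ℝ E₀ H)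
  {M : Type*} [TopologicalSpace M] [ChartedSpace H M]
  (F : Type*) [NormedAddCommGroup F] [NormedSpace ℝ F]
  (V : M → Type*) [TopologicalSpace (TotalSpace F V)]
  [∀ x, AddCommGroup (V x)] [∀ x, Module ℝ (V x)] [∀ x, TopologicalSpace (V x)]
  [FiberBundle F V] [VectorBundle ℝ F V]

/-- The space `Γ(V)` of smooth sections of a vector bundle `V` over `M`. -/
abbrev Sec := Cₛ^∞⟮I; F, V⟯

variable {F V} in
/-- The product `f • s` of a smooth function and a smooth section. -/
def funSMul (f : C^∞⟮I, M; ℝ⟯) (s : Sec I F V) : Sec I F V :=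
  ⟨fun x => f x • s x, f.contMDiff.smul_section s.contMDiff⟩

variable (F₂ : Type*) [NormedAddCommGroup F₂] [NormedSpace ℝ F₂]
  (W : M → Type*) [TopologicalSpace (TotalSpace F₂ W)]
  [∀ x, AddCommGroup (W x)] [∀ x, Module ℝ (W x)] [∀ x, TopologicalSpace (W x)]
  [FiberBundle F₂ W] [VectorBundle ℝ F₂ W]
  [∀ x, IsTopologicalAddGroup (W x)] [∀ x, ContinuousSMul ℝ (W x)]

/-- Smooth vector bundle maps `V → W` covering the identity of `M`,
as smooth sections of the bundle `Hom(V, W)`. -/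
abbrev BundleMap := Cₛ^∞⟮I; F →L[ℝ] F₂, fun x => V x →L[ℝ] W x⟯

variable {F V F₂ W} in
/-- The map `Γ(V) → Γ(W)` induced by a vector bundle map `V → W`. -/
def BundleMap.onSec (L : BundleMap I F V F₂ W) (s : Sec I F V) : Sec I F₂ W :=
  ⟨fun x => L x (s x), fun x =>
    ContMDiffAt.clm_bundle_apply (b := id) (L.contMDiff x) (s.contMDiff x)⟩

/-- A smooth section of `Λ²V*`, as a smooth field of alternating bilinear forms on `V`. -/
structure TwoForm where
  /-- the underlying field of bilinear forms; `form x v` is the covector `η(v, ·)` -/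
  form : Cₛ^∞⟮I; F →L[ℝ] F →L[ℝ] ℝ, fun x => V x →L[ℝ] V x →L[ℝ] ℝ⟯
  alternating : ∀ (x : M) (v : V x), form x v v = 0

/-- A bivector `Λ`, i.e. a smooth section of the second exterior power of `V`, given through its musical morphism `Λ^♯ : V* → V`,
`Λ^♯ α = Λ(α, ·)`, i.e. `Λ(α, β) = β (Λ^♯ α)`, which is required to be skew. -/
structure Bivector [∀ x, IsTopologicalAddGroup (V x)] [∀ x, ContinuousSMul ℝ (V x)] where
  /-- the musical morphism -/
  sharp : BundleMap I (F →L[ℝ] ℝ) (fun x => V x →L[ℝ] ℝ) F V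
  alternating : ∀ (x : M) (α : V x →L[ℝ] ℝ), α (sharp x α) = 0

variable {F V I} in
/-- A two-form is non-degenerate at `x` if `η(v, ·) = 0` on the fibre only for `v = 0`. -/
def TwoForm.NondegenerateAt (η : TwoForm I F V) (x : M) : Prop :=
  ∀ v : V x, (∀ w : V x, η.form x v w = 0) → v = 0

variable {F V I} in
/-- `P` is the bivector dual to the two-form `η`: the maps `P^♯ : V* → V` and
`-η^♭ : V → V*`, `η^♭ v = η(v, ·)`, are inverse to each other. With this sign one has
`P(η^♭ v, η^♭ w) = η(v, w)`. -/
def IsDualBivector [∀ x, IsTopologicalAddGroup (V x)] [∀ x, ContinuousSMul ℝ (V x)]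
    (η : TwoForm I F V) (P : Bivector I F V) : Prop :=
  ∀ x : M, (∀ v : V x, P.sharp x (η.form x v) = -v) ∧
    ∀ α : V x →L[ℝ] ℝ, η.form x (P.sharp x α) = -α

end Basic

/-! ### Vector fields, singular foliations and Poisson structures -/

section Manifold

variable {E₀ : Type*} [NormedAddCommGroup E₀] [NormedSpace ℝ E₀]
  {H : Type*} [TopologicalSpace H] (I : ModelWithCorners ℝ E₀ H)
  (M : Type*) [TopologicalSpace M] [ChartedSpace H M] [IsManifold I ∞ M]

/-- Smooth vector fields `𝔛(M)`. -/
abbrev VField := Sec I E₀ (TangentSpace I : M → Type _)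

/-- Smooth one-forms `Ω¹(M)`. -/
abbrev OneForm := Sec I (E₀ →L[ℝ] ℝ) (fun x : M => TangentSpace I x →L[ℝ] ℝ)

/-- Smooth bivector fields `𝔛²(M)`. -/
abbrev BivectorField := Bivector I E₀ (TangentSpace I : M → Type _)

variable {M}

/-- An almost regular foliation: a `C^∞(M)`-submodule of `𝔛(M)`, closed under the Lie bracket of
vector fields, that is locally free (of some rank `k`): near every point there are `k` elements
whose restrictions generate it and are linearly independent over smooth functions. -/
structure IsAlmostRegularFoliation (E : Set (VField I M)) : Prop where
  zero_mem : (0 : VField I M) ∈ E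
  add_mem : ∀ X ∈ E, ∀ Y ∈ E, X + Y ∈ E
  smul_mem : ∀ (f : C^∞⟮I, M; ℝ⟯), ∀ X ∈ E, funSMul I f X ∈ E
  lie_mem : ∀ X ∈ E, ∀ Y ∈ E, ∃ Z ∈ E, ∀ x, Z x = VectorField.mlieBracket I X Y x
  locally_free : ∃ k : ℕ, ∀ p : M, ∃ U : Set M, IsOpen U ∧ p ∈ U ∧
    ∃ X : Fin k → VField I M, (∀ i, X i ∈ E) ∧
      (∀ Y ∈ E, ∃ f : Fin k → M → ℝ, (∀ i, ContMDiffOn I 𝓘(ℝ, ℝ) ∞ (f i) U) ∧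
        ∀ x ∈ U, Y x = ∑ i, f i x • X i x) ∧
      (∀ f : Fin k → M → ℝ, (∀ i, ContMDiffOn I 𝓘(ℝ, ℝ) ∞ (f i) U) →
        (∀ x ∈ U, ∑ i, f i x • X i x = 0) → ∀ i, ∀ x ∈ U, f i x = 0)

variable {I}

/-- The bracket of functions `{f, g} = Λ(df, dg)` of a bivector field. -/
def bracketFun (Λ : BivectorField I M) (f g : M → ℝ) : M → ℝ :=
  fun x => mvfderiv I g x (Λ.sharp x (mvfderiv I f x))

/-- The Schouten–Nijenhuis bracket `[Λ, σ]` of two bivector fields, evaluated on three exact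
one-forms: `[Λ, σ](df, dg, dh)`. As a bracket of biderivations of `C^∞(M)` it is the cyclic sum of
`Λ(σ(f, g), h) + σ(Λ(f, g), h)`; these values determine the trivector field `[Λ, σ]`. -/
def schouten (Λ σ : BivectorField I M) (f g h : M → ℝ) : M → ℝ :=
  (bracketFun Λ (bracketFun σ f g) h + bracketFun σ (bracketFun Λ f g) h) +
  (bracketFun Λ (bracketFun σ g h) f + bracketFun σ (bracketFun Λ g h) f) +
  (bracketFun Λ (bracketFun σ h f) g + bracketFun σ (bracketFun Λ h f) g)

/-- A Poisson bivector field: `[Λ, Λ] = 0`. -/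
def IsPoisson (Λ : BivectorField I M) : Prop :=
  ∀ f g h : C^∞⟮I, M; ℝ⟯, ∀ x, schouten Λ Λ f g h x = 0

/-- The symplectic foliation `Λ^♯(Ω¹(M))`. -/
def symplecticFoliation (Λ : BivectorField I M) : Set (VField I M) :=
  Set.range fun α : OneForm I M => Λ.sharp.onSec I α

/-- An almost regular Poisson structure. -/
def IsAlmostRegularPoisson (Λ : BivectorField I M) : Prop :=
  IsPoisson Λ ∧ IsAlmostRegularFoliation I (symplecticFoliation Λ)

end Manifold

/-! ### Lie algebroids -/

section Algebroid

variable {E₀ : Type*} [NormedAddCommGroup E₀] [NormedSpace ℝ E₀]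
  {H : Type*} [TopologicalSpace H] (I : ModelWithCorners ℝ E₀ H)
  {M : Type*} [TopologicalSpace M] [ChartedSpace H M] [IsManifold I ∞ M]
  (F : Type*) [NormedAddCommGroup F] [NormedSpace ℝ F]
  (V : M → Type*) [TopologicalSpace (TotalSpace F V)]
  [∀ x, AddCommGroup (V x)] [∀ x, Module ℝ (V x)] [∀ x, TopologicalSpace (V x)]
  [FiberBundle F V] [VectorBundle ℝ F V]

/-- A Lie algebroid structure on the vector bundle `V`: an anchor `ρ : V → TM` and a Lie bracket on
`Γ(V)` with `[a, f b] = df(ρ a) b + f [a, b]`. -/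
structure LieAlgebroid where
  anchor : BundleMap I F V E₀ (TangentSpace I : M → Type _)
  bracket : Sec I F V → Sec I F V → Sec I F V
  bracket_self : ∀ a, bracket a a = 0
  bracket_add_left : ∀ a b c, bracket (a + b) c = bracket a c + bracket b c
  bracket_add_right : ∀ a b c, bracket a (b + c) = bracket a b + bracket a c
  jacobi : ∀ a b c,
    bracket a (bracket b c) + bracket b (bracket c a) + bracket c (bracket a b) = 0
  leibniz : ∀ (a b : Sec I F V) (f : C^∞⟮I, M; ℝ⟯) (x : M),
    bracket a (funSMul I f b) x =
      (mvfderiv I f x (anchor x (a x))) • b x + f x • bracket a b x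

variable {I F V}

/-- The set of vector fields `ρ(Γ(V))`. -/
def LieAlgebroid.foliation (A : LieAlgebroid I F V) : Set (VField I M) :=
  Set.range fun a : Sec I F V => A.anchor.onSec I a

/-- An almost injective (ai-) algebroid: the anchor is injective on the fibres over
an open dense subset. -/
def LieAlgebroid.IsAlmostInjective (A : LieAlgebroid I F V) : Prop :=
  ∃ U : Set M, IsOpen U ∧ Dense U ∧ ∀ x ∈ U, Function.Injective (A.anchor x)

/-- `A` is the ai-algebroid of `E`: it is almost injective and `ρ(Γ(V)) = E`. -/
def LieAlgebroid.IsAiAlgebroidOf (A : LieAlgebroid I F V) (E : Set (VField I M)) : Prop :=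
  A.IsAlmostInjective ∧ A.foliation = E

/-- Full rank: the rank of the bundle is the dimension of `M`. -/
def LieAlgebroid.IsFullRank (_A : LieAlgebroid I F V) : Prop :=
  finrank ℝ F = finrank ℝ E₀

/-- The derivative `ρ(a) f` of a function along a section of the algebroid. -/
def LieAlgebroid.deriv (A : LieAlgebroid I F V) (a : Sec I F V) (f : M → ℝ) : M → ℝ :=
  fun x => mvfderiv I f x (A.anchor x (a x))

/-- The algebroid differential of a two-form, evaluated on three sections (Cartan formula). -/
def LieAlgebroid.dTwo (A : LieAlgebroid I F V) (η : TwoForm I F V) (a b c : Sec I F V) : M → ℝ :=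
  fun x =>
    A.deriv a (fun y => η.form y (b y) (c y)) x
    - A.deriv b (fun y => η.form y (a y) (c y)) x
    + A.deriv c (fun y => η.form y (a y) (b y)) x
    - η.form x (A.bracket a b x) (c x)
    + η.form x (A.bracket a c x) (b x)
    - η.form x (A.bracket b c x) (a x)

/-- Closed two-forms of the algebroid. -/
def LieAlgebroid.IsClosedForm (A : LieAlgebroid I F V) (η : TwoForm I F V) : Prop :=
  ∀ (a b c : Sec I F V) (x : M), A.dTwo η a b c x = 0

/-- Symplectic forms of the algebroid: closed and everywhere non-degenerate two-forms. -/
def LieAlgebroid.IsSymplecticForm (A : LieAlgebroid I F V) (η : TwoForm I F V) : Prop :=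
  A.IsClosedForm η ∧ ∀ x, η.NondegenerateAt x

/-- `B` is the cotangent Lie algebroid of the bivector field `Λ`: the anchor is `Λ^♯` and the
bracket is the one with `[df, dg] = d{f, g}` (which determines it, by the Leibniz rule). -/
def IsCotangentAlgebroid (Λ : BivectorField I M)
    (B : LieAlgebroid I (E₀ →L[ℝ] ℝ) (fun x : M => TangentSpace I x →L[ℝ] ℝ)) : Prop :=
  B.anchor = Λ.sharp ∧
  ∀ (f g : C^∞⟮I, M; ℝ⟯) (α β : OneForm I M),
    (∀ x, α x = mvfderiv I f x) → (∀ x, β x = mvfderiv I g x) →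
    ∀ x, B.bracket α β x = mvfderiv I (bracketFun Λ f g) x

end Algebroid

end EStruct

end

set_option linter.unusedSectionVars false

/-! Write `ρ` for the anchor. Both directions rest on the dictionary between `dη = 0` and the Jacobi
identity, tested on the sections attached to differentials of functions.

For (1), inverting `η` fibrewise gives `P`, which is smooth because inversion of linear maps is. The
sections `X f = P^♯ ρ^* df` satisfy `η(X f, b) = -ρ(b) f`. Since the anchor preserves brackets
(`LieAlgebroid.act_bracket`), `dη` on three of them is minus the Jacobiator
(`isPoisson_of_isClosedForm`). In full rank, `Λ^♯` is injective wherever `ρ` is, hence on a dense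
set, so the images of a local coframe are independent over functions. Closure under the Lie bracket
holds for any Poisson bivector field, through the Koszul bracket (`exists_sharp_eq_lie`).

For (2), the key is that `ρ`, injective only over a dense set of fibres, is injective on all
sections (`LieAlgebroid.IsAlmostInjective.onSec_injective`). Thus `Λ^♯ α`, which lies in `ρ(Γ(A))`,
has a unique lift, and the lifting is linear over functions, so it is a bundle map `l`. It is onto
because every `ρ(a)` is some `Λ^♯ α`. The form is determined by `η(a, l β) = β(ρ a)`, which is
consistent by skewness of `Λ`. Closedness is tensorial, and the vectors `l(df)` fill each fibre, so
it reduces to Jacobi and `[l df, l dg] = l d{f, g}`. In full rank a dimension count makes `l`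
bijective and the bracket of `A` is transported to `T^*M`; the defining identity of `η` is then its
identification with `Λ`. -/

namespace EStruct

/-! ### Global sections from local ones; local frames. -/

section Sections

variable {E₀ : Type*} [NormedAddCommGroup E₀] [NormedSpace ℝ E₀] [FiniteDimensional ℝ E₀]
  {H : Type*} [TopologicalSpace H] (I : ModelWithCorners ℝ E₀ H)
  {M : Type*} [TopologicalSpace M] [ChartedSpace H M] [IsManifold I ∞ M] [T2Space M]
  (F : Type*) [NormedAddCommGroup F] [NormedSpace ℝ F]
  {V : M → Type*} [TopologicalSpace (TotalSpace F V)]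
  [∀ x, AddCommGroup (V x)] [∀ x, Module ℝ (V x)] [∀ x, TopologicalSpace (V x)]
  [FiberBundle F V] [VectorBundle ℝ F V]

variable {F} in
@[simp] lemma funSMul_apply (f : C^∞⟮I, M; ℝ⟯) (s : Sec I F V) (x : M) : funSMul I f s x = f x • s x := rfl

lemma exists_bump_subset {U : Set M} {x : M} (hU : U ∈ 𝓝 x) :
    ∃ f : SmoothBumpFunction I x, tsupport f ⊆ U := by
  obtain ⟨f, -, hf⟩ := (SmoothBumpFunction.nhds_basis_tsupport (I := I) (c := x)).mem_iff.1 hU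
  exact ⟨f, hf⟩

/-- Near a point, a section which is smooth on an open set agrees with a global smooth section. -/
lemma exists_sec_eventuallyEq {U : Set M} (hU : IsOpen U) {x : M} (hx : x ∈ U)
    {s : Π x : M, V x} (hs : ContMDiffOn I (I.prod 𝓘(ℝ, F)) ∞ (fun x => TotalSpace.mk' F x (s x)) U) :
    ∃ σ : Sec I F V, ∀ᶠ y in 𝓝 x, σ y = s y := by
  obtain ⟨f, hf⟩ := exists_bump_subset I (hU.mem_nhds hx)
  refine ⟨⟨_, ContMDiffOn.smul_section_of_tsupport f.contMDiff.contMDiffOn hU hf hs⟩, ?_⟩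
  filter_upwards [f.eventuallyEq_one] with y hy
  change f y • s y = s y
  rw [hy]; simp

lemma exists_fun_eventuallyEq {U : Set M} (hU : IsOpen U) {x : M} (hx : x ∈ U)
    {s : M → ℝ} (hs : ContMDiffOn I 𝓘(ℝ, ℝ) ∞ s U) :
    ∃ σ : C^∞⟮I, M; ℝ⟯, ∀ᶠ y in 𝓝 x, σ y = s y := by
  obtain ⟨f, hf⟩ := exists_bump_subset I (hU.mem_nhds hx)
  refine ⟨⟨fun y => f y * s y, ?_⟩, ?_⟩
  · apply contMDiff_of_tsupport
    intro y hy
    have hyU : y ∈ U := hf (closure_mono (fun z hz => left_ne_zero_of_mul hz) hy)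
    exact f.contMDiffAt.mul (hs.contMDiffAt (hU.mem_nhds hyU))
  · filter_upwards [f.eventuallyEq_one] with y hy
    change f y * s y = s y
    rw [hy]; simp

lemma exists_sec_apply_eq [ContMDiffVectorBundle ∞ F V I] {x : M} (v : V x) :
    ∃ σ : Sec I F V, σ x = v := by
  obtain ⟨s, hs, h⟩ := FiberBundle.exists_contMDiffOn_extend (k := ∞) I F v
  obtain ⟨U, hUs, hU, hx⟩ := mem_nhds_iff.1 hs
  obtain ⟨σ, hσ⟩ := exists_sec_eventuallyEq I F hU hx (h.mono hUs)
  exact ⟨σ, by simpa using hσ.self_of_nhds⟩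

/-- Every point has a neighbourhood on which finitely many global sections form a frame. -/
lemma exists_frame [FiniteDimensional ℝ F] [ContMDiffVectorBundle ∞ F V I] (x : M) :
    ∃ U : Set M, IsOpen U ∧ x ∈ U ∧ ∃ b : Fin (finrank ℝ F) → Sec I F V,
      (∀ s : Sec I F V, ∃ c : Fin (finrank ℝ F) → M → ℝ,
        (∀ i, ContMDiffOn I 𝓘(ℝ, ℝ) ∞ (c i) U) ∧ ∀ y ∈ U, s y = ∑ i, c i y • b i y) ∧
      ∀ y ∈ U, LinearIndependent ℝ (fun i => b i y) := by
  set e := trivializationAt F V x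
  have hxe : x ∈ e.baseSet := FiberBundle.mem_baseSet_trivializationAt' x
  have : ContMDiffVectorBundle 1 F V I := ContMDiffVectorBundle.of_le (n := ∞) (by simp)
  let B := finBasis ℝ F
  have h1 : ∀ i, ∃ σ : Sec I F V, ∀ᶠ y in 𝓝 x, σ y = e.localFrame B i y := fun i =>
    exists_sec_eventuallyEq I F e.open_baseSet hxe (e.contMDiffOn_localFrame_baseSet ∞ B i)
  -- The cut-off sections agree with the trivialization frame only near `x`, so the neighbourhood
  -- has to shrink to where all of them do.
  choose b hb using h1
  have h2 : ∀ᶠ y in 𝓝 x, y ∈ e.baseSet ∧ ∀ i, b i y = e.localFrame B i y :=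
    Filter.Eventually.and (e.open_baseSet.mem_nhds hxe) (Filter.eventually_all.2 hb)
  obtain ⟨U, hUs, hU, hxU⟩ := eventually_nhds_iff.1 h2
  have hloc := e.isLocalFrameOn_localFrame_baseSet I ∞ B
  refine ⟨U, hU, hxU, b, fun s => ⟨fun i y => e.localFrameCoeff I B i y (s y), fun i => ?_, ?_⟩, ?_⟩
  · exact contMDiffOn_localFrameCoeff B hU (fun y hy => (hUs y hy).1) s.contMDiff.contMDiffOn i
  · intro y hy
    refine (e.eq_sum_localFrameCoeff_smul (s := s) (I := I) (b := B) (hUs y hy).1).trans ?_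
    exact Finset.sum_congr rfl fun i _ => by rw [(hUs y hy).2 i]
  · intro y hy
    have := hloc.linearIndependent (hUs y hy).1
    simpa only [(hUs y hy).2] using this

/-- Near a point every section is a combination of fixed sections with global coefficients. -/
lemma exists_frame_global [FiniteDimensional ℝ F] [ContMDiffVectorBundle ∞ F V I] (x : M) :
    ∃ b : Fin (finrank ℝ F) → Sec I F V,
      LinearIndependent ℝ (fun i => b i x) ∧
      ∀ s : Sec I F V, ∃ c : Fin (finrank ℝ F) → C^∞⟮I, M; ℝ⟯,
        ∀ᶠ y in 𝓝 x, s y = ∑ i, c i y • b i y := by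
  obtain ⟨U, hU, hxU, b, hb, hli⟩ := exists_frame I F (V := V) x
  refine ⟨b, hli x hxU, fun s => ?_⟩
  obtain ⟨c, hc, hs⟩ := hb s
  choose c' hc' using fun i => exists_fun_eventuallyEq I hU hxU (hc i)
  refine ⟨c', ?_⟩
  filter_upwards [hU.mem_nhds hxU, Filter.eventually_all.2 hc'] with y hy hy'
  rw [hs y hy]
  exact Finset.sum_congr rfl fun i _ => by rw [hy']

end Sections

/-! ### Maps linear over functions depend only on the value at a point. -/

section Tensoriality

variable {E₀ : Type*} [NormedAddCommGroup E₀] [NormedSpace ℝ E₀] [FiniteDimensional ℝ E₀]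
  {H : Type*} [TopologicalSpace H] {I : ModelWithCorners ℝ E₀ H}
  {M : Type*} [TopologicalSpace M] [ChartedSpace H M] [IsManifold I ∞ M] [T2Space M]
  {F : Type*} [NormedAddCommGroup F] [NormedSpace ℝ F]
  {V : M → Type*} [TopologicalSpace (TotalSpace F V)]
  [∀ x, AddCommGroup (V x)] [∀ x, Module ℝ (V x)] [∀ x, TopologicalSpace (V x)]
  [FiberBundle F V] [VectorBundle ℝ F V]

/-- Locality: a bump function equal to 1 at `x` and supported where `s` vanishes kills `s` without
changing `T s`. -/
lemma tensorial_eventuallyEq_zero {A : Type*} [AddCommGroup A] [Module ℝ A] {x : M}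
    {T : Sec I F V → A} (hsmul : ∀ (f : C^∞⟮I, M; ℝ⟯) s, T (funSMul I f s) = f x • T s)
    {s : Sec I F V} (hs : ∀ᶠ y in 𝓝 x, s y = 0) : T s = 0 := by
  obtain ⟨f, hf⟩ := exists_bump_subset I hs
  let g : C^∞⟮I, M; ℝ⟯ := ⟨f, f.contMDiff⟩
  have h : funSMul I g s = 0 := by
    ext y
    by_cases hy : y ∈ tsupport f
    · have : s y = 0 := hf hy
      simp [this]
    · have : g y = 0 := image_eq_zero_of_notMem_tsupport hy
      simp [this]
  have h0 : T 0 = 0 := by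
    have : funSMul I (0 : C^∞⟮I, M; ℝ⟯) (0 : Sec I F V) = 0 := by ext y; simp
    rw [← this, hsmul]; simp
  have hg : g x = 1 := f.eq_one
  have := hsmul g s
  rwa [h, h0, hg, one_smul, eq_comm] at this

/-- In a frame the coefficients of `s` vanish at `x`, so each term contributes zero; the difference
between `s` and its globalized expansion vanishes near `x` and is handled by locality. -/
lemma tensorial_zero [FiniteDimensional ℝ F] [ContMDiffVectorBundle ∞ F V I]
    {A : Type*} [AddCommGroup A] [Module ℝ A] {x : M}
    {T : Sec I F V → A} (hadd : ∀ s t, T (s + t) = T s + T t)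
    (hsmul : ∀ (f : C^∞⟮I, M; ℝ⟯) s, T (funSMul I f s) = f x • T s)
    {s : Sec I F V} (hs : s x = 0) : T s = 0 := by
  obtain ⟨b, hli, hb⟩ := exists_frame_global I F (V := V) x
  obtain ⟨c, hc⟩ := hb s
  have hc0 : ∀ i, c i x = 0 := by
    have := hc.self_of_nhds
    rw [hs] at this
    exact Fintype.linearIndependent_iff.1 hli (fun i => c i x) this.symm
  let T' : Sec I F V →+ A := AddMonoidHom.mk' T hadd
  have h1 : T (s - ∑ i, funSMul I (c i) (b i)) = 0 := by
    apply tensorial_eventuallyEq_zero hsmul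
    filter_upwards [hc] with y hy
    have : (∑ i, funSMul I (c i) (b i)) y = ∑ i, c i y • b i y := by
      have := map_sum (AddMonoidHom.mk' (fun t : Sec I F V => t y) fun _ _ => rfl)
        (fun i => funSMul I (c i) (b i)) Finset.univ
      exact this
    rw [ContMDiffSection.coe_sub, Pi.sub_apply, this, hy, sub_self]
  have h2 : T' (s - ∑ i, funSMul I (c i) (b i)) = 0 := h1
  rw [map_sub, map_sum, sub_eq_zero] at h2
  change T s = _ at h2
  rw [h2]
  exact Finset.sum_eq_zero fun i _ => by
    change T _ = 0
    rw [hsmul, hc0, zero_smul]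

lemma tensorial_congr [FiniteDimensional ℝ F] [ContMDiffVectorBundle ∞ F V I]
    {A : Type*} [AddCommGroup A] [Module ℝ A] {x : M}
    {T : Sec I F V → A} (hadd : ∀ s t, T (s + t) = T s + T t)
    (hsmul : ∀ (f : C^∞⟮I, M; ℝ⟯) s, T (funSMul I f s) = f x • T s)
    {s t : Sec I F V} (hs : s x = t x) : T s = T t := by
  have := hadd (s - t) t
  rw [sub_add_cancel, tensorial_zero hadd hsmul (s := s - t)] at this
  · simpa using this
  · simp [hs]

end Tensoriality

/-! ### Smoothness of bundle maps tested on sections. -/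

section Smoothness

variable {E₀ : Type*} [NormedAddCommGroup E₀] [NormedSpace ℝ E₀] [FiniteDimensional ℝ E₀]
  {H : Type*} [TopologicalSpace H] {I : ModelWithCorners ℝ E₀ H}
  {M : Type*} [TopologicalSpace M] [ChartedSpace H M] [IsManifold I ∞ M] [T2Space M]
  {F : Type*} [NormedAddCommGroup F] [NormedSpace ℝ F] [FiniteDimensional ℝ F]
  {V : M → Type*} [TopologicalSpace (TotalSpace F V)]
  [∀ x, AddCommGroup (V x)] [∀ x, Module ℝ (V x)] [∀ x, TopologicalSpace (V x)]
  [FiberBundle F V] [VectorBundle ℝ F V] [ContMDiffVectorBundle ∞ F V I]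
  {F₂ : Type*} [NormedAddCommGroup F₂] [NormedSpace ℝ F₂]
  {W : M → Type*} [TopologicalSpace (TotalSpace F₂ W)]
  [∀ x, AddCommGroup (W x)] [∀ x, Module ℝ (W x)] [∀ x, TopologicalSpace (W x)]
  [FiberBundle F₂ W] [VectorBundle ℝ F₂ W]
  [∀ x, IsTopologicalAddGroup (W x)] [∀ x, ContinuousSMul ℝ (W x)]

lemma contMDiffAt_clm_of_apply {x : M} {A : M → F →L[ℝ] F₂}
    (h : ∀ v, ContMDiffAt I 𝓘(ℝ, F₂) ∞ (fun y => A y v) x) :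
    ContMDiffAt I 𝓘(ℝ, F →L[ℝ] F₂) ∞ A x := by
  let B := finBasis ℝ F
  have : A = fun y => ∑ i, ContinuousLinearMap.smulRightL ℝ F F₂
      (LinearMap.toContinuousLinearMap (B.coord i)) (A y (B i)) := by
    funext y
    ext v
    conv_lhs => rw [← B.sum_repr v]
    simp only [map_sum, map_smul]
    simp
  rw [this]
  apply ContMDiffAt.sum
  intro i _
  exact (ContinuousLinearMap.contMDiff _).contMDiffAt.comp x (h (B i))

/-- A field of linear maps which sends smooth sections to smooth sections is smooth. -/
lemma contMDiff_hom_of_apply {φ : Π x : M, V x →L[ℝ] W x}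
    (h : ∀ s : Sec I F V, ContMDiff I (I.prod 𝓘(ℝ, F₂)) ∞
      (fun x => TotalSpace.mk' F₂ x (φ x (s x)))) :
    ContMDiff I (I.prod 𝓘(ℝ, F →L[ℝ] F₂)) ∞
      (fun x => TotalSpace.mk' (F →L[ℝ] F₂) (E := fun x => V x →L[ℝ] W x) x (φ x)) := by
  intro x
  rw [contMDiffAt_hom_bundle]
  refine ⟨contMDiffAt_id, contMDiffAt_clm_of_apply fun v => ?_⟩
  set e := trivializationAt F V x
  set e' := trivializationAt F₂ W x
  have hxe : x ∈ e.baseSet := FiberBundle.mem_baseSet_trivializationAt' x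
  have hxe' : x ∈ e'.baseSet := FiberBundle.mem_baseSet_trivializationAt' x
  -- The section that is constantly `v` in the trivialization: the map applied to it is a column of
  -- the coordinate expression.
  have hs : ContMDiffOn I (I.prod 𝓘(ℝ, F)) ∞
      (fun y => TotalSpace.mk' F y (e.symm y v)) e.baseSet := by
    rw [e.contMDiffOn_section_baseSet_iff]
    apply (contMDiffOn_const (c := v)).congr
    intro y hy
    simp [hy]
  obtain ⟨σ, hσ⟩ := exists_sec_eventuallyEq I F e.open_baseSet hxe hs
  have h2 := (contMDiffAt_section _).1 (h σ x)
  refine h2.congr_of_eventuallyEq ?_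
  filter_upwards [hσ, e.open_baseSet.mem_nhds hxe, e'.open_baseSet.mem_nhds hxe'] with y hy h1 h3
  rw [ContinuousLinearMap.inCoordinates_eq h1 h3]
  simp [hy, e, e']

/-- The inverse image of a smooth section under a bijective vector bundle map is smooth. -/
lemma contMDiff_of_bijective_apply [FiniteDimensional ℝ F₂]
    [∀ x, IsTopologicalAddGroup (V x)] [∀ x, ContinuousSMul ℝ (V x)]
    (L : BundleMap I F V F₂ W) (hL : ∀ x, Function.Bijective (L x))
    {s : Π x : M, V x}
    (hs : ContMDiff I (I.prod 𝓘(ℝ, F₂)) ∞ (fun x => TotalSpace.mk' F₂ x (L x (s x)))) :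
    ContMDiff I (I.prod 𝓘(ℝ, F)) ∞ (fun x => TotalSpace.mk' F x (s x)) := by
  have := FiniteDimensional.complete ℝ F
  intro x
  have h1 := ((contMDiffAt_hom_bundle _).1 (L.contMDiff x)).2
  have h2 := (contMDiffAt_section _).1 (hs x)
  rw [contMDiffAt_section]
  set e := trivializationAt F V x
  set e' := trivializationAt F₂ W x
  have hxe : x ∈ e.baseSet := FiberBundle.mem_baseSet_trivializationAt' x
  have hxe' : x ∈ e'.baseSet := FiberBundle.mem_baseSet_trivializationAt' x
  simp only at h1
  set A : M → F →L[ℝ] F₂ := fun y =>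
    ContinuousLinearMap.inCoordinates F V F₂ W x y x y (L y) with hA
  -- In trivializations the map is an invertible operator `A y`, and `s` is recovered as `(A y)⁻¹`
  -- applied to the coordinates of `L s`; inversion is smooth at invertible operators.
  have key : ∀ y ∈ e.baseSet, y ∈ e'.baseSet → ∃ a : F ≃L[ℝ] F₂, (a : F →L[ℝ] F₂) = A y ∧
      ∀ v, A y ((e ⟨y, v⟩).2) = (e' ⟨y, L y v⟩).2 := by
    intro y h1 h3
    have hAy : A y = _ := ContinuousLinearMap.inCoordinates_eq h1 h3
    have hbij : Function.Bijective (A y) := by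
      rw [hAy]
      exact (e'.continuousLinearEquivAt ℝ y h3).bijective.comp
        ((hL y).comp (e.continuousLinearEquivAt ℝ y h1).symm.bijective)
    refine ⟨(LinearEquiv.ofBijective (A y : F →ₗ[ℝ] F₂) hbij).toContinuousLinearEquiv, ?_, ?_⟩
    · ext v; rfl
    · intro v
      rw [hAy]
      simp [e, e', h1]
  obtain ⟨a₀, ha₀, -⟩ := key x hxe hxe'
  have h3 : ContMDiffAt I 𝓘(ℝ, F₂ →L[ℝ] F) ∞ (fun y => (A y).inverse) x := by
    have : ContDiffAt ℝ ∞ (ContinuousLinearMap.inverse : (F →L[ℝ] F₂) → (F₂ →L[ℝ] F)) (A x) := by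
      rw [← ha₀]; exact contDiffAt_map_inverse a₀
    exact this.contMDiffAt.comp x h1
  refine (h3.clm_apply h2).congr_of_eventuallyEq ?_
  filter_upwards [e.open_baseSet.mem_nhds hxe, e'.open_baseSet.mem_nhds hxe'] with y h4 h5
  obtain ⟨a, ha, hv⟩ := key y h4 h5
  rw [← hv (s y), ← ha]
  simp

end Smoothness

/-! ### Differentials of functions and vector fields as derivations. -/

section Derivations

variable {E₀ : Type*} [NormedAddCommGroup E₀] [NormedSpace ℝ E₀] [FiniteDimensional ℝ E₀]
  {H : Type*} [TopologicalSpace H] {I : ModelWithCorners ℝ E₀ H}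
  {M : Type*} [TopologicalSpace M] [ChartedSpace H M] [IsManifold I ∞ M] [T2Space M]
  {F : Type*} [NormedAddCommGroup F] [NormedSpace ℝ F]
  {V : M → Type*} [TopologicalSpace (TotalSpace F V)]
  [∀ x, AddCommGroup (V x)] [∀ x, Module ℝ (V x)] [∀ x, TopologicalSpace (V x)]
  [FiberBundle F V] [VectorBundle ℝ F V]

/-- A real function is smooth iff it is smooth as a section of the trivial line bundle. -/
lemma contMDiff_trivial_section_iff {f : M → ℝ} :
    ContMDiff I (I.prod 𝓘(ℝ, ℝ)) ∞ (fun x => TotalSpace.mk' ℝ (E := fun _ : M => ℝ) x (f x)) ↔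
      ContMDiff I 𝓘(ℝ, ℝ) ∞ f := by
  refine forall_congr' fun x => ?_
  rw [contMDiffAt_section]
  rfl

/-- The smooth function `x ↦ α_x(s_x)`. -/
noncomputable def pairing (α : Sec I (F →L[ℝ] ℝ) (fun x => V x →L[ℝ] ℝ)) (s : Sec I F V) :
    C^∞⟮I, M; ℝ⟯ :=
  ⟨fun x => α x (s x), contMDiff_trivial_section_iff.1 fun x =>
    ContMDiffAt.clm_bundle_apply (b := id) (α.contMDiff x) (s.contMDiff x)⟩

/-- The smooth function `η(a, b)`. -/
noncomputable def TwoForm.eval (η : TwoForm I F V) (a b : Sec I F V) : C^∞⟮I, M; ℝ⟯ :=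
  pairing (BundleMap.onSec I η.form a) b

@[simp] lemma TwoForm.eval_apply (η : TwoForm I F V) (a b : Sec I F V) (x : M) :
    η.eval a b x = η.form x (a x) (b x) := rfl

/-- The differential of a smooth function, as a one-form. -/
noncomputable def dForm (f : C^∞⟮I, M; ℝ⟯) : OneForm I M :=
  ⟨fun x => mvfderiv I f x, fun x => by
    rw [contMDiffAt_hom_bundle]
    refine ⟨contMDiffAt_id, ?_⟩
    have h := f.contMDiff.contMDiffAt (x := x) |>.mfderiv_const (m := ∞) (by simp)
    refine h.congr_of_eventuallyEq ?_
    filter_upwards [(trivializationAt E₀ (TangentSpace I : M → Type _) x).open_baseSet.mem_nhds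
      (FiberBundle.mem_baseSet_trivializationAt' x)] with y hy
    have hy' : id y ∈ (trivializationAt E₀ (TangentSpace I : M → Type _) (id x)).baseSet := hy
    simp only [inTangentCoordinates]
    rw [ContinuousLinearMap.inCoordinates_eq hy (by simp),
      ContinuousLinearMap.inCoordinates_eq (y₀ := f x) (y := f y) hy' (mem_univ (f y))]
    ext v
    simp
    exact (congrArg Prod.snd (trivializationAt_model_space_apply (I := 𝓘(ℝ, ℝ))
      (TotalSpace.mk' ℝ (f y) _ : TangentBundle 𝓘(ℝ, ℝ) ℝ) (f x))).symm⟩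

/-- The derivative `X f`. -/
noncomputable def VField.act (X : VField I M) (f : C^∞⟮I, M; ℝ⟯) : C^∞⟮I, M; ℝ⟯ :=
  pairing (dForm f) X

lemma VField.act_apply (X : VField I M) (f : C^∞⟮I, M; ℝ⟯) (x : M) :
    VField.act X f x = mvfderiv I f x (X x) := rfl

lemma _root_.ContMDiffMap.mdifferentiableAt_coe (f : C^∞⟮I, M; ℝ⟯) (x : M) : MDifferentiableAt I 𝓘(ℝ, ℝ) f x :=
  f.contMDiff.contMDiffAt.mdifferentiableAt (by simp)

lemma mvfderiv_map_add (f g : C^∞⟮I, M; ℝ⟯) (x : M) :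
    mvfderiv I (f + g : C^∞⟮I, M; ℝ⟯) x = mvfderiv I f x + mvfderiv I g x :=
  mvfderiv_add (f.mdifferentiableAt_coe x) (g.mdifferentiableAt_coe x)

lemma mvfderiv_map_neg (f : C^∞⟮I, M; ℝ⟯) (x : M) :
    mvfderiv I (-f : C^∞⟮I, M; ℝ⟯) x = - mvfderiv I f x := by
  exact mvfderiv_neg

lemma mvfderiv_map_mul (f g : C^∞⟮I, M; ℝ⟯) (x : M) :
    mvfderiv I (f * g : C^∞⟮I, M; ℝ⟯) x = f x • mvfderiv I g x + g x • mvfderiv I f x :=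
  mvfderiv_mul (f.mdifferentiableAt_coe x) (g.mdifferentiableAt_coe x)

lemma mvfderiv_congr {f g : M → ℝ} {x : M} (h : f =ᶠ[𝓝 x] g) :
    mvfderiv I f x = mvfderiv I g x := by
  ext v
  simp only [mvfderiv, h.mfderiv_eq]
  rfl

/-- Every covector is the differential of a global smooth function. -/
lemma exists_mvfderiv_eq {x : M} (α : TangentSpace I x →L[ℝ] ℝ) :
    ∃ f : C^∞⟮I, M; ℝ⟯, mvfderiv I f x = α := by
  let α' : E₀ →L[ℝ] ℝ := α
  have hsm : ContMDiffOn I 𝓘(ℝ, ℝ) ∞ (α' ∘ extChartAt I x) (chartAt H x).source :=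
    α'.contMDiff.comp_contMDiffOn contMDiffOn_extChartAt
  obtain ⟨f, hf⟩ := exists_fun_eventuallyEq I (chartAt H x).open_source (mem_chart_source H x) hsm
  refine ⟨f, ?_⟩
  rw [mvfderiv_congr hf]
  ext v
  rw [mvfderiv_comp_apply x ((α'.contMDiff (n := 1)).contMDiffAt.mdifferentiableAt one_ne_zero)
    (mdifferentiableAt_extChartAt (mem_chart_source H x)), mfderiv_extChartAt_self]
  simp only [mvfderiv, mfderiv_eq_fderiv, α'.fderiv]
  rfl

/-- Tangent vectors are separated by differentials of global smooth functions. -/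
lemma tangent_ext {x : M} {v w : TangentSpace I x}
    (h : ∀ f : C^∞⟮I, M; ℝ⟯, mvfderiv I f x v = mvfderiv I f x w) : v = w := by
  let v' : E₀ := v
  let w' : E₀ := w
  change v' = w'
  refine (SeparatingDual.eq_iff_forall_dual_eq (R := ℝ)).2 fun α => ?_
  obtain ⟨f, hf⟩ := exists_mvfderiv_eq (I := I) (x := x) α
  have := h f
  rwa [hf] at this

/-- A vector field read in the chart at `x`. -/
noncomputable def chartField (X : VField I M) (x : M) (y : E₀) : E₀ :=
  VectorField.mpullbackWithin 𝓘(ℝ, E₀) I (extChartAt I x).symm X (range I) y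

/-- Chain rule for the inverse chart. It is needed on the whole chart target, not just at the base
point, so that `X f` can be differentiated once more. -/
lemma fderiv_comp_extChartAt_symm_chartField [I.Boundaryless] (X : VField I M)
    (f : C^∞⟮I, M; ℝ⟯) (x : M) {y : E₀} (hy : y ∈ (extChartAt I x).target) :
    fderiv ℝ (f ∘ (extChartAt I x).symm) y (chartField X x y) =
      VField.act X f ((extChartAt I x).symm y) := by
  have hinv := isInvertible_mfderivWithin_extChartAt_symm hy
  have hmd : MDifferentiableAt 𝓘(ℝ, E₀) I (extChartAt I x).symm y := by
    have := mdifferentiableWithinAt_extChartAt_symm hy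
    rwa [I.range_eq_univ, mdifferentiableWithinAt_univ] at this
  set w : E₀ := chartField X x y with hw
  have h1 : mvfderiv 𝓘(ℝ, E₀) (f ∘ (extChartAt I x).symm) y w =
      mvfderiv I f ((extChartAt I x).symm y) (mfderiv 𝓘(ℝ, E₀) I (extChartAt I x).symm y w) :=
    mvfderiv_comp_apply y (f.mdifferentiableAt_coe _) hmd _
  have h2 : mfderiv 𝓘(ℝ, E₀) I (extChartAt I x).symm y w = X ((extChartAt I x).symm y) := by
    rw [I.range_eq_univ, mfderivWithin_univ] at hinv
    simp only [hw, chartField, VectorField.mpullbackWithin, I.range_eq_univ, mfderivWithin_univ]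
    exact hinv.self_apply_inverse _
  rw [VField.act_apply, ← h2, ← h1]
  simp only [mvfderiv, mfderiv_eq_fderiv]
  rfl

/-- The Lie bracket of vector fields is the commutator of derivations. -/
lemma mvfderiv_mlieBracket [I.Boundaryless] (X Y : VField I M) (f : C^∞⟮I, M; ℝ⟯) (x : M) :
    mvfderiv I f x (VectorField.mlieBracket I X Y x) =
      mvfderiv I (VField.act Y f) x (X x) - mvfderiv I (VField.act X f) x (Y x) := by
  set φ := extChartAt I x with hφ
  set y₀ : E₀ := φ x
  have hy₀ : y₀ ∈ φ.target := mem_extChartAt_target x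
  have hx : φ.symm y₀ = x := extChartAt_to_inv x
  have htgt : φ.target ∈ 𝓝 y₀ := extChartAt_target_mem_nhds x
  have hdiff : ∀ Z : VField I M, DifferentiableAt ℝ (chartField Z x) y₀ := by
    intro Z
    have : IsManifold I 2 M := IsManifold.of_le (n := ∞) ENat.LEInfty.out
    have h := (Z.contMDiff.contMDiffAt (x := x)).mdifferentiableAt (by simp)
    rw [← mdifferentiableWithinAt_univ] at h
    have h' := h.differentiableWithinAt_mpullbackWithin_vectorField
    rw [preimage_univ, univ_inter, I.range_eq_univ] at h'
    have h2 := differentiableWithinAt_univ.1 h'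
    have h3 : chartField Z x = VectorField.mpullbackWithin 𝓘(ℝ, E₀) I (extChartAt I x).symm Z univ := by
      rw [← I.range_eq_univ]; rfl
    rw [h3]
    exact h2
  have hsm : ∀ g : C^∞⟮I, M; ℝ⟯, ContDiffAt ℝ ∞ (g ∘ φ.symm) y₀ := by
    intro g
    rw [← contMDiffAt_iff_contDiffAt]
    refine g.contMDiff.contMDiffAt.comp y₀ ?_
    exact (contMDiffOn_extChartAt_symm x).contMDiffAt htgt
  have hact : ∀ (Z : VField I M) (g : C^∞⟮I, M; ℝ⟯),
      mvfderiv I g x (Z x) = fderiv ℝ (g ∘ φ.symm) y₀ (chartField Z x y₀) := by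
    intro Z g
    rw [fderiv_comp_extChartAt_symm_chartField Z g x hy₀, hx]
    rfl
  -- A second derivative of `f` plus a first derivative of the components of `Z`; antisymmetrizing
  -- leaves only the latter.
  have hiter : ∀ Z W : VField I M, mvfderiv I (VField.act Z f) x (W x) =
      fderiv ℝ (fderiv ℝ (f ∘ φ.symm)) y₀ (chartField W x y₀) (chartField Z x y₀) +
        fderiv ℝ (f ∘ φ.symm) y₀ (fderiv ℝ (chartField Z x) y₀ (chartField W x y₀)) := by
    intro Z W
    rw [hact W]
    have : (VField.act Z f) ∘ φ.symm =ᶠ[𝓝 y₀]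
        fun y => fderiv ℝ (f ∘ φ.symm) y (chartField Z x y) := by
      filter_upwards [htgt] with y hy
      exact (fderiv_comp_extChartAt_symm_chartField Z f x hy).symm
    rw [this.fderiv_eq, fderiv_clm_apply]
    · simp [add_comm]
    · exact ((hsm f).fderiv_right (m := ∞) (by simp)).differentiableAt (by simp)
    · exact hdiff Z
  have hbr : mvfderiv I f x (VectorField.mlieBracket I X Y x) =
      fderiv ℝ (f ∘ φ.symm) y₀ (VectorField.lieBracket ℝ (chartField X x) (chartField Y x) y₀) := by
    have h1 : VectorField.mlieBracket I X Y x =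
        VectorField.lieBracket ℝ (chartField X x) (chartField Y x) y₀ := by
      rw [VectorField.mlieBracket, VectorField.mlieBracketWithin_apply, mfderiv_extChartAt_self]
      change (ContinuousLinearMap.id ℝ E₀).inverse (VectorField.lieBracketWithin ℝ
        (chartField X x) (chartField Y x) (φ.symm ⁻¹' univ ∩ range I) y₀) = _
      rw [ContinuousLinearMap.inverse_id, preimage_univ, univ_inter, I.range_eq_univ,
        VectorField.lieBracketWithin_univ]
      rfl
    have h2 : mvfderiv I f x = fderiv ℝ (f ∘ φ.symm) y₀ := by
      have hcg : f =ᶠ[𝓝 x] (f ∘ φ.symm) ∘ φ := by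
        filter_upwards [extChartAt_source_mem_nhds (I := I) x] with y hy
        simp only [Function.comp_apply, hφ, (extChartAt I x).left_inv hy]
      have hd : MDifferentiableAt 𝓘(ℝ, E₀) 𝓘(ℝ, ℝ) (f ∘ φ.symm) (φ x) :=
        ((hsm f).differentiableAt (by simp)).mdifferentiableAt
      rw [mvfderiv_congr hcg]
      ext v
      rw [mvfderiv_comp_apply x hd (mdifferentiableAt_extChartAt (mem_chart_source H x)),
        mfderiv_extChartAt_self]
      simp only [mvfderiv, mfderiv_eq_fderiv]
      rfl
    rw [h1, h2]
    rfl
  -- Symmetry of the second derivative cancels the second-order terms of the commutator.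
  have hsymm : IsSymmSndFDerivAt ℝ (f ∘ φ.symm) y₀ :=
    (hsm f).isSymmSndFDerivAt (by rw [minSmoothness_of_isRCLikeNormedField]; exact ENat.LEInfty.out)
  rw [hbr, hiter, hiter, VectorField.lieBracket, map_sub, hsymm.eq (chartField X x y₀)]
  ring

end Derivations

/-! ### Bundle maps, inverses and duals from linear maps of sections. -/

section BundleMaps

variable {E₀ : Type*} [NormedAddCommGroup E₀] [NormedSpace ℝ E₀] [FiniteDimensional ℝ E₀]
  {H : Type*} [TopologicalSpace H] {I : ModelWithCorners ℝ E₀ H}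
  {M : Type*} [TopologicalSpace M] [ChartedSpace H M] [IsManifold I ∞ M] [T2Space M]
  {F : Type*} [NormedAddCommGroup F] [NormedSpace ℝ F] [FiniteDimensional ℝ F]
  {V : M → Type*} [TopologicalSpace (TotalSpace F V)]
  [∀ x, AddCommGroup (V x)] [∀ x, Module ℝ (V x)] [∀ x, TopologicalSpace (V x)]
  [FiberBundle F V] [VectorBundle ℝ F V]

variable (F) in
/-- Fibres of a vector bundle are isomorphic to the model fibre. -/
noncomputable def fiberEquiv (x : M) : V x ≃L[ℝ] F :=
  (trivializationAt F V x).continuousLinearEquivAt ℝ x (FiberBundle.mem_baseSet_trivializationAt' x)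

variable (F) in
lemma finrank_fiber (x : M) : finrank ℝ (V x) = finrank ℝ F :=
  (fiberEquiv F (V := V) x).toLinearEquiv.finrank_eq

lemma finrank_strongDual (F : Type*) [NormedAddCommGroup F] [NormedSpace ℝ F]
    [FiniteDimensional ℝ F] : finrank ℝ (F →L[ℝ] ℝ) = finrank ℝ F :=
  (LinearMap.toContinuousLinearMap (𝕜 := ℝ) (E := F) (F' := ℝ)).finrank_eq.symm.trans
    Subspace.dual_finrank_eq

variable
  {F₂ : Type*} [NormedAddCommGroup F₂] [NormedSpace ℝ F₂] [FiniteDimensional ℝ F₂]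
  {W : M → Type*} [TopologicalSpace (TotalSpace F₂ W)]
  [∀ x, AddCommGroup (W x)] [∀ x, Module ℝ (W x)] [∀ x, TopologicalSpace (W x)]
  [FiberBundle F₂ W] [VectorBundle ℝ F₂ W]
  [∀ x, IsTopologicalAddGroup (V x)] [∀ x, ContinuousSMul ℝ (V x)]
  [∀ x, IsTopologicalAddGroup (W x)] [∀ x, ContinuousSMul ℝ (W x)]

@[simp] lemma BundleMap.onSec_apply (L : BundleMap I F V F₂ W) (s : Sec I F V) (x : M) :
    L.onSec I s x = L x (s x) := rfl

/-- A linear map between fibres is continuous. -/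
noncomputable def fiberMap (F : Type*) [NormedAddCommGroup F] [NormedSpace ℝ F]
    [FiniteDimensional ℝ F] [TopologicalSpace (TotalSpace F V)] [FiberBundle F V]
    [VectorBundle ℝ F V] {x : M} (φ : V x →ₗ[ℝ] W x) : V x →L[ℝ] W x :=
  have := (fiberEquiv F (V := V) x).symm.toLinearEquiv.finiteDimensional
  have := (fiberEquiv F (V := V) x).toHomeomorph.symm.t2Space
  LinearMap.toContinuousLinearMap φ

/-- A bijective vector bundle map is an isomorphism. -/
lemma BundleMap.exists_inverse [ContMDiffVectorBundle ∞ F V I] [ContMDiffVectorBundle ∞ F₂ W I] (L : BundleMap I F V F₂ W)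
    (hL : ∀ x, Function.Bijective (L x)) :
    ∃ K : BundleMap I F₂ W F V, (∀ x v, K x (L x v) = v) ∧ ∀ x w, L x (K x w) = w := by
  let K : Π x, W x →L[ℝ] V x := fun x =>
    fiberMap F₂ (LinearEquiv.ofBijective (L x : V x →ₗ[ℝ] W x) (hL x)).symm.toLinearMap
  have h1 : ∀ x w, L x (K x w) = w := fun x w =>
    (LinearEquiv.ofBijective (L x : V x →ₗ[ℝ] W x) (hL x)).apply_symm_apply w
  refine ⟨⟨K, contMDiff_hom_of_apply fun s => contMDiff_of_bijective_apply L hL ?_⟩,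
    fun x v => (hL x).1 (h1 x _), h1⟩
  simpa only [h1] using s.contMDiff

/-- A `C^∞(M)`-linear map between spaces of sections is induced by a vector bundle map. -/
lemma exists_bundleMap_of_linear [ContMDiffVectorBundle ∞ F V I] (Φ : Sec I F V → Sec I F₂ W)
    (hadd : ∀ s t, Φ (s + t) = Φ s + Φ t)
    (hsmul : ∀ (f : C^∞⟮I, M; ℝ⟯) s, Φ (funSMul I f s) = funSMul I f (Φ s)) :
    ∃ L : BundleMap I F V F₂ W, ∀ s x, L x (s x) = Φ s x := by
  have hcongr : ∀ (x : M) (s t : Sec I F V), s x = t x → Φ s x = Φ t x := by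
    intro x s t h
    refine tensorial_congr (T := fun s => Φ s x) (fun s t => ?_) (fun f s => ?_) h
    · simp [hadd]
    · simp [hsmul]
  -- The fibre map is evaluated on an arbitrary extension of the vector; `hcongr` makes it
  -- independent of the choice, hence linear.
  choose ext hext using fun (x : M) (v : V x) => exists_sec_apply_eq I F v
  let φ : Π x, V x →ₗ[ℝ] W x := fun x =>
    { toFun v := Φ (ext x v) x
      map_add' v w := by
        rw [← Pi.add_apply, ← ContMDiffSection.coe_add, ← hadd]
        exact hcongr x _ _ (by simp [hext])
      map_smul' c v := by
        let k : C^∞⟮I, M; ℝ⟯ := ⟨fun _ => c, contMDiff_const⟩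
        have : Φ (funSMul I k (ext x v)) x = c • Φ (ext x v) x := by rw [hsmul]; rfl
        rw [RingHom.id_apply, ← this]
        refine hcongr x _ _ ?_
        rw [hext, funSMul_apply, hext]
        rfl }
  have hφ : ∀ (s : Sec I F V) (x : M), fiberMap F (φ x) (s x) = Φ s x := fun s x =>
    hcongr x _ _ (hext x _)
  refine ⟨⟨fun x => fiberMap F (φ x), contMDiff_hom_of_apply fun s => ?_⟩, hφ⟩
  simpa only [hφ] using (Φ s).contMDiff

lemma BundleMap.ext_of_sec [ContMDiffVectorBundle ∞ F V I] {L K : BundleMap I F V F₂ W}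
    (h : ∀ (s : Sec I F V) x, L x (s x) = K x (s x)) : L = K := by
  ext x v
  obtain ⟨s, rfl⟩ := exists_sec_apply_eq I F v
  exact h s x

/-- A field of covectors is smooth if its values on smooth sections are. -/
lemma contMDiff_dual_of_apply [ContMDiffVectorBundle ∞ F V I] {φ : Π x : M, V x →L[ℝ] ℝ}
    (h : ∀ s : Sec I F V, ContMDiff I 𝓘(ℝ, ℝ) ∞ (fun x => φ x (s x))) :
    ContMDiff I (I.prod 𝓘(ℝ, F →L[ℝ] ℝ)) ∞
      (fun x => TotalSpace.mk' (F →L[ℝ] ℝ) (E := fun x => V x →L[ℝ] ℝ) x (φ x)) :=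
  contMDiff_hom_of_apply (W := fun _ : M => ℝ) fun s => contMDiff_trivial_section_iff.2 (h s)

/-- The transpose of a vector bundle map, on sections. -/
noncomputable def BundleMap.pullSec [ContMDiffVectorBundle ∞ F V I] (L : BundleMap I F V F₂ W)
    (α : Sec I (F₂ →L[ℝ] ℝ) (fun x => W x →L[ℝ] ℝ)) : Sec I (F →L[ℝ] ℝ) (fun x => V x →L[ℝ] ℝ) :=
  ⟨fun x => (α x).comp (L x), contMDiff_dual_of_apply fun s => (pairing α (L.onSec I s)).contMDiff⟩

/-- A `C^∞(M)`-linear functional on sections is a section of the dual bundle. -/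
lemma exists_dual_of_linear [ContMDiffVectorBundle ∞ F V I] (Φ : Sec I F V → C^∞⟮I, M; ℝ⟯)
    (hadd : ∀ s t, Φ (s + t) = Φ s + Φ t)
    (hsmul : ∀ (f : C^∞⟮I, M; ℝ⟯) s, Φ (funSMul I f s) = f * Φ s) :
    ∃ α : Sec I (F →L[ℝ] ℝ) (fun x => V x →L[ℝ] ℝ), ∀ s x, α x (s x) = Φ s x := by
  let toSec (f : C^∞⟮I, M; ℝ⟯) : Sec I ℝ (fun _ : M => ℝ) :=
    ⟨f, contMDiff_trivial_section_iff.2 f.contMDiff⟩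
  exact exists_bundleMap_of_linear (W := fun _ : M => ℝ) (fun s => toSec (Φ s))
    (fun s t => by rw [hadd]; rfl) (fun f s => by rw [hsmul]; rfl)

end BundleMaps

/-! ### Hamiltonian vector fields and the Jacobi identity. -/

section Poisson

variable {E₀ : Type*} [NormedAddCommGroup E₀] [NormedSpace ℝ E₀] [FiniteDimensional ℝ E₀]
  {H : Type*} [TopologicalSpace H] {I : ModelWithCorners ℝ E₀ H}
  {M : Type*} [TopologicalSpace M] [ChartedSpace H M] [IsManifold I ∞ M] [T2Space M]

@[simp] lemma VField.act_map_add (X : VField I M) (f g : C^∞⟮I, M; ℝ⟯) :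
    VField.act X (f + g) = VField.act X f + VField.act X g := by
  ext x; exact congrArg (fun α : TangentSpace I x →L[ℝ] ℝ => α (X x)) (mvfderiv_map_add f g x)

@[simp] lemma VField.act_map_neg (X : VField I M) (f : C^∞⟮I, M; ℝ⟯) :
    VField.act X (-f) = - VField.act X f := by
  ext x; exact congrArg (fun α : TangentSpace I x →L[ℝ] ℝ => α (X x)) (mvfderiv_map_neg f x)

@[simp] lemma VField.act_map_mul (X : VField I M) (f g : C^∞⟮I, M; ℝ⟯) :
    VField.act X (f * g) = f * VField.act X g + g * VField.act X f := by
  ext x; exact congrArg (fun α : TangentSpace I x →L[ℝ] ℝ => α (X x)) (mvfderiv_map_mul f g x)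

@[simp] lemma VField.add_act (X Y : VField I M) (f : C^∞⟮I, M; ℝ⟯) :
    VField.act (X + Y) f = VField.act X f + VField.act Y f := by
  ext x; simp [VField.act_apply]

@[simp] lemma VField.smul_act (X : VField I M) (f g : C^∞⟮I, M; ℝ⟯) :
    VField.act (funSMul I g X) f = g * VField.act X f := by
  ext x; simp [VField.act_apply]

lemma VField.ext_act {X Y : VField I M} (h : ∀ f, VField.act X f = VField.act Y f) : X = Y := by
  ext x
  exact tangent_ext fun f => congrArg (fun g : C^∞⟮I, M; ℝ⟯ => g x) (h f)

/-- The Hamiltonian vector field `Λ^♯(df)`. -/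
noncomputable def hamiltonian (Λ : BivectorField I M) (f : C^∞⟮I, M; ℝ⟯) : VField I M :=
  Λ.sharp.onSec I (dForm f)

/-- The bracket of smooth functions, as a smooth function. -/
noncomputable def poisson (Λ : BivectorField I M) (f g : C^∞⟮I, M; ℝ⟯) : C^∞⟮I, M; ℝ⟯ :=
  VField.act (hamiltonian Λ f) g

lemma coe_poisson (Λ : BivectorField I M) (f g : C^∞⟮I, M; ℝ⟯) :
    (poisson Λ f g : M → ℝ) = bracketFun Λ f g := rfl

lemma Bivector.skew (Λ : BivectorField I M) (x : M) (α β : TangentSpace I x →L[ℝ] ℝ) :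
    β (Λ.sharp x α) = - α (Λ.sharp x β) := by
  have h := Λ.alternating x (α + β)
  simp only [map_add, add_apply, Λ.alternating] at h
  linarith

lemma sharp_add (Λ : BivectorField I M) (α β : OneForm I M) :
    Λ.sharp.onSec I (α + β) = Λ.sharp.onSec I α + Λ.sharp.onSec I β := by
  ext x; exact map_add (Λ.sharp x) (α x) (β x)

lemma sharp_funSMul (Λ : BivectorField I M) (α : OneForm I M) (f : C^∞⟮I, M; ℝ⟯) :
    Λ.sharp.onSec I (funSMul I f α) = funSMul I f (Λ.sharp.onSec I α) := by
  ext x; exact map_smul (Λ.sharp x) (f x) (α x)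

lemma poisson_skew (Λ : BivectorField I M) (f g : C^∞⟮I, M; ℝ⟯) :
    poisson Λ f g = - poisson Λ g f := by
  ext x
  exact Λ.skew x _ _

/-- By skewness, the Schouten bracket of `Λ` with itself is `-2` times the Jacobiator. -/
lemma isPoisson_iff (Λ : BivectorField I M) : IsPoisson Λ ↔ ∀ f g h : C^∞⟮I, M; ℝ⟯,
    poisson Λ f (poisson Λ g h) + poisson Λ g (poisson Λ h f) + poisson Λ h (poisson Λ f g) = 0 := by
  have key : ∀ (f g h : C^∞⟮I, M; ℝ⟯) (x : M), schouten Λ Λ f g h x = -2 *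
      (poisson Λ f (poisson Λ g h) + poisson Λ g (poisson Λ h f) + poisson Λ h (poisson Λ f g)) x := by
    intro f g h x
    rw [poisson_skew Λ f (poisson Λ g h), poisson_skew Λ g (poisson Λ h f),
      poisson_skew Λ h (poisson Λ f g)]
    simp only [schouten, Pi.add_apply, ← coe_poisson, ContMDiffMap.coe_add, ContMDiffMap.coe_neg,
      Pi.neg_apply]
    ring
  constructor
  · intro hP f g h
    ext x
    have := hP f g h x
    rw [key] at this
    simpa using this
  · intro hJ f g h x
    rw [key, hJ]
    simp

lemma hamiltonian_poisson {Λ : BivectorField I M} (hΛ : IsPoisson Λ) (f g h : C^∞⟮I, M; ℝ⟯) :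
    VField.act (hamiltonian Λ (poisson Λ f g)) h =
      VField.act (hamiltonian Λ f) (VField.act (hamiltonian Λ g) h) -
        VField.act (hamiltonian Λ g) (VField.act (hamiltonian Λ f) h) := by
  change poisson Λ (poisson Λ f g) h = poisson Λ f (poisson Λ g h) - poisson Λ g (poisson Λ f h)
  have := (isPoisson_iff Λ).1 hΛ f g h
  rw [poisson_skew Λ h f, poisson_skew Λ h] at this
  simp only [poisson, VField.act_map_neg] at this ⊢
  rw [eq_comm, ← sub_eq_zero, ← this]
  abel

end Poisson

/-! ### The anchor preserves brackets. -/

section Algebroid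

variable {E₀ : Type*} [NormedAddCommGroup E₀] [NormedSpace ℝ E₀] [FiniteDimensional ℝ E₀]
  {H : Type*} [TopologicalSpace H] {I : ModelWithCorners ℝ E₀ H}
  {M : Type*} [TopologicalSpace M] [ChartedSpace H M] [IsManifold I ∞ M] [T2Space M]
  {F : Type*} [NormedAddCommGroup F] [NormedSpace ℝ F] [FiniteDimensional ℝ F]
  {V : M → Type*} [TopologicalSpace (TotalSpace F V)]
  [∀ x, AddCommGroup (V x)] [∀ x, Module ℝ (V x)] [∀ x, TopologicalSpace (V x)]
  [FiberBundle F V] [VectorBundle ℝ F V] [ContMDiffVectorBundle ∞ F V I]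
  (A : LieAlgebroid I F V)

/-- The derivative `ρ(a) f`, as a smooth function. -/
noncomputable def LieAlgebroid.act (a : Sec I F V) (f : C^∞⟮I, M; ℝ⟯) : C^∞⟮I, M; ℝ⟯ :=
  VField.act (A.anchor.onSec I a) f

lemma LieAlgebroid.act_apply (a : Sec I F V) (f : C^∞⟮I, M; ℝ⟯) (x : M) :
    A.act a f x = mvfderiv I f x (A.anchor x (a x)) := rfl

lemma LieAlgebroid.bracket_skew (a b : Sec I F V) : A.bracket a b = - A.bracket b a := by
  have := A.bracket_self (a + b)
  rw [A.bracket_add_left, A.bracket_add_right, A.bracket_add_right, A.bracket_self, A.bracket_self,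
    zero_add, add_zero] at this
  exact eq_neg_of_add_eq_zero_left this

lemma LieAlgebroid.bracket_neg_right (a b : Sec I F V) : A.bracket a (-b) = - A.bracket a b :=
  (AddMonoidHom.mk' (A.bracket a) (A.bracket_add_right a)).map_neg b

lemma LieAlgebroid.bracket_funSMul (a b : Sec I F V) (f : C^∞⟮I, M; ℝ⟯) :
    A.bracket a (funSMul I f b) = funSMul I (A.act a f) b + funSMul I f (A.bracket a b) := by
  ext x
  exact A.leibniz a b f x

/-- The anchor of a Lie algebroid is a morphism of brackets. -/
lemma LieAlgebroid.act_bracket (a b : Sec I F V) (f : C^∞⟮I, M; ℝ⟯) :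
    A.act (A.bracket a b) f = A.act a (A.act b f) - A.act b (A.act a f) := by
  ext x
  have key : ∀ v : V x, (A.act a (A.act b f) x - A.act b (A.act a f) x
      - A.act (A.bracket a b) f x) • v = 0 := by
    intro v
    obtain ⟨c, rfl⟩ := exists_sec_apply_eq I F v
    -- Expanding Jacobi for `a, b, f c` by Leibniz and subtracting `f` times Jacobi for `a, b, c`
    -- leaves exactly the bracket defect on `f`, times `c`.
    have h1 := A.jacobi a b (funSMul I f c)
    have h2 := congrArg (fun s => funSMul I f s) (A.jacobi a b c)
    rw [A.bracket_skew (funSMul I f c) a, A.bracket_skew (funSMul I f c) (A.bracket a b),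
      A.bracket_neg_right] at h1
    rw [A.bracket_skew c a, A.bracket_skew c (A.bracket a b), A.bracket_neg_right] at h2
    simp only [A.bracket_funSMul, A.bracket_add_right] at h1
    have h1x := congrArg (fun s : Sec I F V => s x) h1
    have h2x := congrArg (fun s : Sec I F V => s x) h2
    simp only [ContMDiffSection.coe_add, ContMDiffSection.coe_neg, Pi.add_apply, Pi.neg_apply,
      funSMul_apply, ContMDiffSection.coe_zero, Pi.zero_apply, smul_zero, smul_add, smul_neg]
      at h1x h2x
    rw [sub_smul, sub_smul, ← sub_eq_zero.2 (h1x.trans h2x.symm)]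
    abel
  -- In a nonzero fibre a nonzero vector can be cancelled; over a zero fibre every section vanishes,
  -- and so do all three derivatives.
  rcases subsingleton_or_nontrivial (V x) with hV | hV
  · have : ∀ c : Sec I F V, c x = 0 := fun c => Subsingleton.elim _ _
    simp [A.act_apply, this]
  · obtain ⟨v, hv⟩ := exists_ne (0 : V x)
    have := (smul_eq_zero.1 (key v)).resolve_right hv
    simp only [ContMDiffMap.coe_sub, Pi.sub_apply]
    linarith

lemma TwoForm.skew (η : TwoForm I F V) (x : M) (v w : V x) : η.form x v w = - η.form x w v := by
  have h := η.alternating x (v + w)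
  simp only [map_add, add_apply, η.alternating] at h
  linarith

lemma LieAlgebroid.dTwo_eq (η : TwoForm I F V) (a b c : Sec I F V) (x : M) :
    A.dTwo η a b c x = A.act a (η.eval b c) x - A.act b (η.eval a c) x + A.act c (η.eval a b) x
      - η.eval (A.bracket a b) c x + η.eval (A.bracket a c) b x - η.eval (A.bracket b c) a x := rfl

end Algebroid

/-! ### From a symplectic form to a Poisson bivector. -/

section SymplecticToPoisson

variable {E₀ : Type*} [NormedAddCommGroup E₀] [NormedSpace ℝ E₀] [FiniteDimensional ℝ E₀]
  {H : Type*} [TopologicalSpace H] {I : ModelWithCorners ℝ E₀ H}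
  {M : Type*} [TopologicalSpace M] [ChartedSpace H M] [IsManifold I ∞ M] [T2Space M]
  {F : Type*} [NormedAddCommGroup F] [NormedSpace ℝ F] [FiniteDimensional ℝ F]
  {V : M → Type*} [TopologicalSpace (TotalSpace F V)]
  [∀ x, AddCommGroup (V x)] [∀ x, Module ℝ (V x)] [∀ x, TopologicalSpace (V x)]
  [∀ x, IsTopologicalAddGroup (V x)] [∀ x, ContinuousSMul ℝ (V x)]
  [FiberBundle F V] [VectorBundle ℝ F V] [ContMDiffVectorBundle ∞ F V I]
  {A : LieAlgebroid I F V}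

lemma TwoForm.bijective_of_nondegenerateAt (η : TwoForm I F V) {x : M}
    (h : η.NondegenerateAt x) : Function.Bijective (η.form x) := by
  have := (fiberEquiv F (V := V) x).symm.toLinearEquiv.finiteDimensional
  have := (fiberEquiv (F →L[ℝ] ℝ) (V := fun x => V x →L[ℝ] ℝ) x).symm.toLinearEquiv.finiteDimensional
  have hinj : Function.Injective (η.form x : V x →ₗ[ℝ] (V x →L[ℝ] ℝ)) := by
    rw [← LinearMap.ker_eq_bot, LinearMap.ker_eq_bot']
    intro v hv
    exact h v fun w => congrArg (fun α : V x →L[ℝ] ℝ => α w) hv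
  refine ⟨hinj, (LinearMap.injective_iff_surjective_of_finrank_eq_finrank ?_).1 hinj⟩
  rw [finrank_fiber F, finrank_fiber (F →L[ℝ] ℝ) (V := fun x => V x →L[ℝ] ℝ), finrank_strongDual]

lemma IsDualBivector.ext {η : TwoForm I F V} {P Q : Bivector I F V} (hP : IsDualBivector η P)
    (hQ : IsDualBivector η Q) : P = Q := by
  have h : P.sharp = Q.sharp := by
    ext x α
    have h1 := (hP x).1 (Q.sharp x α)
    rw [(hQ x).2 α, map_neg] at h1
    exact neg_injective h1
  cases P; cases Q; congr

lemma exists_isDualBivector (η : TwoForm I F V) (hη : ∀ x, η.NondegenerateAt x) :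
    ∃ P : Bivector I F V, IsDualBivector η P := by
  obtain ⟨K, hK1, hK2⟩ := BundleMap.exists_inverse (W := fun x => V x →L[ℝ] ℝ) η.form
    fun x => η.bijective_of_nondegenerateAt (hη x)
  refine ⟨⟨-K, fun x α => ?_⟩, fun x => ⟨fun v => ?_, fun α => ?_⟩⟩
  -- With `K` inverse to `η^♭`, `α(K α) = η(K α, K α) = 0`.
  · have h := η.alternating x (K x α)
    rw [hK2] at h
    change α (-(K x α)) = 0
    rw [map_neg, h, neg_zero]
  · exact congrArg Neg.neg (hK1 x v)
  · change η.form x (-(K x α)) = -α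
    rw [map_neg, hK2]

/-- The bundle map `P^♯ ∘ ρ^*`. -/
lemma exists_sharp_transpose (P : Bivector I F V) (A : LieAlgebroid I F V) :
    ∃ l : BundleMap I (E₀ →L[ℝ] ℝ) (fun x : M => TangentSpace I x →L[ℝ] ℝ) F V,
      ∀ (x : M) (α : TangentSpace I x →L[ℝ] ℝ), l x α = P.sharp x (α.comp (A.anchor x)) := by
  refine ⟨⟨fun x => (P.sharp x).comp (ContinuousLinearMap.precomp ℝ (A.anchor x)),
    contMDiff_hom_of_apply fun s => ?_⟩, fun x α => rfl⟩
  exact (P.sharp.onSec I (A.anchor.pullSec s)).contMDiff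

/-- Composition with the anchor. -/
lemma exists_anchor_comp (A : LieAlgebroid I F V)
    (l : BundleMap I (E₀ →L[ℝ] ℝ) (fun x : M => TangentSpace I x →L[ℝ] ℝ) F V) :
    ∃ L : BundleMap I (E₀ →L[ℝ] ℝ) (fun x : M => TangentSpace I x →L[ℝ] ℝ)
        E₀ (TangentSpace I : M → Type _),
      ∀ (x : M) (α : TangentSpace I x →L[ℝ] ℝ), L x α = A.anchor x (l x α) :=
  ⟨⟨fun x => (A.anchor x).comp (l x), contMDiff_hom_of_apply fun s =>
    (A.anchor.onSec I (l.onSec I s)).contMDiff⟩, fun _ _ => rfl⟩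

lemma exists_pushforward_bivector (P : Bivector I F V) (A : LieAlgebroid I F V) :
    ∃ Λ : BivectorField I M, ∀ (x : M) (α : TangentSpace I x →L[ℝ] ℝ),
      Λ.sharp x α = A.anchor x (P.sharp x (α.comp (A.anchor x))) := by
  obtain ⟨l, hl⟩ := exists_sharp_transpose P A
  obtain ⟨L, hL⟩ := exists_anchor_comp A l
  refine ⟨⟨L, fun x α => ?_⟩, fun x α => by rw [hL, hl]⟩
  rw [hL, hl]
  exact P.alternating x (α.comp (A.anchor x))

/-- On the sections `X f = P^♯ ρ^* df` both the values of `η` and the anchored derivatives are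
Poisson brackets, so closedness becomes an identity among iterated brackets. -/
lemma isPoisson_of_isClosedForm {η : TwoForm I F V} (hη : A.IsClosedForm η) {P : Bivector I F V}
    (hP : IsDualBivector η P) {Λ : BivectorField I M}
    (hΛ : ∀ (x : M) (α : TangentSpace I x →L[ℝ] ℝ),
      Λ.sharp x α = A.anchor x (P.sharp x (α.comp (A.anchor x)))) : IsPoisson Λ := by
  obtain ⟨l, hl⟩ := exists_sharp_transpose P A
  set X : C^∞⟮I, M; ℝ⟯ → Sec I F V := fun f => l.onSec I (dForm f) with hX
  have hact : ∀ f g, A.act (X f) g = poisson Λ f g := by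
    intro f g
    ext x
    change mvfderiv I g x (A.anchor x (l x (mvfderiv I f x))) =
      mvfderiv I g x (Λ.sharp x (mvfderiv I f x))
    rw [hΛ, hl]
  have heta : ∀ f b, η.eval (X f) b = - A.act b f := by
    intro f b
    ext x
    change η.form x (l x (mvfderiv I f x)) (b x) = - mvfderiv I f x (A.anchor x (b x))
    rw [hl, (hP x).2]
    rfl
  have heta' : ∀ f b, η.eval b (X f) = A.act b f := by
    intro f b
    ext x
    have h := congrArg (fun g : C^∞⟮I, M; ℝ⟯ => g x) (heta f b)
    simp only [TwoForm.eval_apply, ContMDiffMap.coe_neg, Pi.neg_apply] at h ⊢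
    rw [η.skew, h, neg_neg]
  rw [isPoisson_iff]
  intro f g h
  ext x
  -- The derivative terms give the Jacobiator once, the bracket terms give it twice with the
  -- opposite sign.
  have hd := hη (X f) (X g) (X h) x
  rw [A.dTwo_eq] at hd
  simp only [heta', A.act_bracket] at hd
  simp only [hact, ContMDiffMap.coe_sub, ContMDiffMap.coe_add, Pi.sub_apply, Pi.add_apply,
    ContMDiffMap.coe_zero, Pi.zero_apply] at hd ⊢
  rw [poisson_skew Λ h g, poisson_skew Λ f h, poisson_skew Λ g f] at hd
  have e1 : ∀ a b : C^∞⟮I, M; ℝ⟯, poisson Λ a (-b) = - poisson Λ a b := fun a b =>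
    VField.act_map_neg _ _
  simp only [e1, ContMDiffMap.coe_neg, Pi.neg_apply] at hd ⊢
  linarith

end SymplecticToPoisson

/-! ### The Koszul bracket and involutivity of the image of `Λ^♯`. -/

section KoszulForm

variable {E₀ : Type*} [NormedAddCommGroup E₀] [NormedSpace ℝ E₀] [FiniteDimensional ℝ E₀]
  {H : Type*} [TopologicalSpace H] {I : ModelWithCorners ℝ E₀ H} [I.Boundaryless]
  {M : Type*} [TopologicalSpace M] [ChartedSpace H M] [IsManifold I ∞ M] [T2Space M]

/-- The Lie bracket of smooth vector fields, as a smooth vector field. -/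
noncomputable def lie (X Y : VField I M) : VField I M :=
  ⟨VectorField.mlieBracket I X Y, fun x => by
    have : IsManifold I (minSmoothness ℝ 2) M := by
      rw [minSmoothness_of_isRCLikeNormedField]
      exact IsManifold.of_le (n := ∞) ENat.LEInfty.out
    have : IsManifold I (∞ + 1) M := by simpa using ‹IsManifold I ∞ M›
    exact ContMDiffAt.mlieBracket_vectorField (n := ⊤) (m := ⊤) (X.contMDiff x) (Y.contMDiff x) (by simp)⟩

lemma lie_act (X Y : VField I M) (f : C^∞⟮I, M; ℝ⟯) :
    VField.act (lie X Y) f = VField.act X (VField.act Y f) - VField.act Y (VField.act X f) := by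
  ext x
  exact mvfderiv_mlieBracket X Y f x

lemma lie_skew (X Y : VField I M) : lie X Y = - lie Y X := by
  ext x
  exact VectorField.mlieBracket_swap_apply

lemma lie_add_right (X Y Z : VField I M) : lie X (Y + Z) = lie X Y + lie X Z := by
  refine VField.ext_act fun f => ?_
  simp only [lie_act, VField.add_act, VField.act_map_add]
  abel

lemma lie_funSMul_right (X Y : VField I M) (g : C^∞⟮I, M; ℝ⟯) :
    lie X (funSMul I g Y) = funSMul I (VField.act X g) Y + funSMul I g (lie X Y) := by
  refine VField.ext_act fun f => ?_
  simp only [lie_act, VField.add_act, VField.smul_act, VField.act_map_mul]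
  ring

lemma lie_add_left (X Y Z : VField I M) : lie (X + Y) Z = lie X Z + lie Y Z := by
  rw [lie_skew, lie_add_right, lie_skew Z X, lie_skew Z Y]
  abel

lemma lie_funSMul_left (X Y : VField I M) (g : C^∞⟮I, M; ℝ⟯) :
    lie (funSMul I g X) Y = funSMul I g (lie X Y) - funSMul I (VField.act Y g) X := by
  refine VField.ext_act fun f => ?_
  rw [sub_eq_add_neg, VField.add_act]
  have : ∀ Z : VField I M, VField.act (-Z) f = - VField.act Z f := fun Z => by
    ext x; simp [VField.act_apply]
  simp only [this, lie_act, VField.smul_act, VField.act_map_mul]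
  ring

lemma pairing_add_right (α : OneForm I M) (X Y : VField I M) :
    pairing α (X + Y) = pairing α X + pairing α Y := by
  ext x; exact map_add (α x) (X x) (Y x)

lemma pairing_sub_right (α : OneForm I M) (X Y : VField I M) :
    pairing α (X - Y) = pairing α X - pairing α Y := by
  ext x; exact map_sub (α x) (X x) (Y x)

lemma pairing_funSMul_right (α : OneForm I M) (X : VField I M) (f : C^∞⟮I, M; ℝ⟯) :
    pairing α (funSMul I f X) = f * pairing α X := by
  ext x; exact map_smul (α x) (f x) (X x)

lemma pairing_add_left (α β : OneForm I M) (X : VField I M) :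
    pairing (α + β) X = pairing α X + pairing β X := rfl

lemma pairing_funSMul_left (α : OneForm I M) (X : VField I M) (f : C^∞⟮I, M; ℝ⟯) :
    pairing (funSMul I f α) X = f * pairing α X := rfl

lemma pairing_dForm (f : C^∞⟮I, M; ℝ⟯) (X : VField I M) :
    pairing (dForm f) X = VField.act X f := rfl

lemma pairing_sharp_skew (Λ : BivectorField I M) (α β : OneForm I M) :
    pairing β (Λ.sharp.onSec I α) = - pairing α (Λ.sharp.onSec I β) := by
  ext x; exact Λ.skew x (α x) (β x)

/-- The difference between `[Λ^♯ α, Λ^♯ β] h` and the derivative of `h` along the image of the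
Koszul bracket of `α` and `β`. -/
noncomputable def koszulDefect (Λ : BivectorField I M) (h : C^∞⟮I, M; ℝ⟯) (α β : OneForm I M) :
    C^∞⟮I, M; ℝ⟯ :=
  pairing β (lie (Λ.sharp.onSec I α) (hamiltonian Λ h))
    - pairing α (lie (Λ.sharp.onSec I β) (hamiltonian Λ h))
    + VField.act (hamiltonian Λ h) (pairing β (Λ.sharp.onSec I α))

lemma koszulDefect_skew (Λ : BivectorField I M) (h : C^∞⟮I, M; ℝ⟯) (α β : OneForm I M) :
    koszulDefect Λ h α β = - koszulDefect Λ h β α := by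
  simp only [koszulDefect]
  rw [pairing_sharp_skew Λ α β, VField.act_map_neg]
  ring

lemma koszulDefect_add_left (Λ : BivectorField I M) (h : C^∞⟮I, M; ℝ⟯) (α α' β : OneForm I M) :
    koszulDefect Λ h (α + α') β = koszulDefect Λ h α β + koszulDefect Λ h α' β := by
  simp only [koszulDefect, sharp_add, lie_add_left, pairing_add_left, pairing_add_right,
    VField.act_map_add]
  ring

/-- The term with the derivative of `f` along the Hamiltonian field of `h` arises once from the Lie
bracket and once from the last summand, with opposite signs. -/
lemma koszulDefect_funSMul_left (Λ : BivectorField I M) (h f : C^∞⟮I, M; ℝ⟯) (α β : OneForm I M) :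
    koszulDefect Λ h (funSMul I f α) β = f * koszulDefect Λ h α β := by
  simp only [koszulDefect, sharp_funSMul, lie_funSMul_left, pairing_funSMul_left,
    pairing_sub_right, pairing_funSMul_right, VField.act_map_mul]
  ring

lemma koszulDefect_congr_left (Λ : BivectorField I M) (h : C^∞⟮I, M; ℝ⟯) {α α' : OneForm I M}
    (β : OneForm I M) {x : M} (hx : α x = α' x) :
    koszulDefect Λ h α β x = koszulDefect Λ h α' β x := by
  refine tensorial_congr (T := fun α => koszulDefect Λ h α β x) (fun s t => ?_) (fun f s => ?_) hx
  · simp [koszulDefect_add_left]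
  · simp [koszulDefect_funSMul_left]

/-- By tensoriality and skewness both one-forms may be replaced at `x` by exact ones, for which the
claim is the Jacobi identity. -/
lemma koszulDefect_eq_zero {Λ : BivectorField I M} (hΛ : IsPoisson Λ) (h : C^∞⟮I, M; ℝ⟯)
    (α β : OneForm I M) : koszulDefect Λ h α β = 0 := by
  ext x
  obtain ⟨f, hf⟩ := exists_mvfderiv_eq (α x)
  obtain ⟨g, hg⟩ := exists_mvfderiv_eq (β x)
  rw [koszulDefect_congr_left Λ h β (α' := dForm f) hf.symm, koszulDefect_skew,
    ContMDiffMap.coe_neg, Pi.neg_apply, koszulDefect_congr_left Λ h _ (α' := dForm g) hg.symm]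
  have : koszulDefect Λ h (dForm g) (dForm f) = 0 := by
    have hJ := hamiltonian_poisson hΛ g f h
    simp only [koszulDefect, pairing_dForm, lie_act]
    change VField.act (hamiltonian Λ g) (poisson Λ h f)
      - VField.act (hamiltonian Λ h) (poisson Λ g f)
      - (VField.act (hamiltonian Λ f) (poisson Λ h g)
        - VField.act (hamiltonian Λ h) (poisson Λ f g))
      + VField.act (hamiltonian Λ h) (poisson Λ g f) = 0
    change poisson Λ _ h = VField.act (hamiltonian Λ g) (poisson Λ f h)
      - VField.act (hamiltonian Λ f) (poisson Λ g h) at hJ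
    rw [poisson_skew Λ _ h] at hJ
    change - VField.act (hamiltonian Λ h) (poisson Λ g f) = _ at hJ
    rw [poisson_skew Λ h f, poisson_skew Λ h g, poisson_skew Λ f g]
    simp only [VField.act_map_neg]
    linear_combination hJ
  rw [this]
  simp

/-- The Koszul bracket of two one-forms realizes the Lie bracket of their images under `Λ^♯`. -/
lemma exists_sharp_eq_lie {Λ : BivectorField I M} (hΛ : IsPoisson Λ) (α β : OneForm I M) :
    ∃ γ : OneForm I M, Λ.sharp.onSec I γ = lie (Λ.sharp.onSec I α) (Λ.sharp.onSec I β) := by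
  set X := Λ.sharp.onSec I α with hX
  set Y := Λ.sharp.onSec I β with hY
  -- `γ` is the Koszul bracket `L_X β - L_Y α - d(Λ(α, β))`, written through its values on vector
  -- fields.
  obtain ⟨γ, hγ⟩ := exists_dual_of_linear (I := I) (V := (TangentSpace I : M → Type _))
    (fun Z : VField I M => VField.act X (pairing β Z) - pairing β (lie X Z)
      - VField.act Y (pairing α Z) + pairing α (lie Y Z) - VField.act Z (pairing β X))
    (fun Z W => by
      simp only [pairing_add_right, lie_add_right, VField.act_map_add, VField.add_act]
      ring)
    (fun f Z => by
      have := pairing_sharp_skew Λ α β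
      rw [← hX, ← hY] at this
      simp only [pairing_funSMul_right, pairing_add_right, lie_funSMul_right, VField.act_map_mul,
        VField.smul_act, this, VField.act_map_neg]
      ring)
  refine ⟨γ, VField.ext_act fun h => ?_⟩
  have h1 : VField.act (Λ.sharp.onSec I γ) h = - pairing γ (hamiltonian Λ h) :=
    pairing_sharp_skew Λ γ (dForm h)
  have h2 : pairing γ (hamiltonian Λ h) = _ := ContMDiffMap.ext fun x => hγ (hamiltonian Λ h) x
  have h3 : ∀ δ : OneForm I M, pairing δ (hamiltonian Λ h) = - VField.act (Λ.sharp.onSec I δ) h :=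
    fun δ => pairing_sharp_skew Λ (dForm h) δ
  have h4 := koszulDefect_eq_zero hΛ h α β
  rw [h1, h2, h3, h3, lie_act, VField.act_map_neg, VField.act_map_neg]
  rw [koszulDefect, ← hX, ← hY] at h4
  linear_combination h4

end KoszulForm

/-! ### Almost regularity from injectivity on a dense set. -/

section AlmostRegular

variable {E₀ : Type*} [NormedAddCommGroup E₀] [NormedSpace ℝ E₀] [FiniteDimensional ℝ E₀]
  {H : Type*} [TopologicalSpace H] {I : ModelWithCorners ℝ E₀ H} [I.Boundaryless]
  {M : Type*} [TopologicalSpace M] [ChartedSpace H M] [IsManifold I ∞ M] [T2Space M]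

/-- A continuous function is nonzero on an open set, which would meet `D`. This turns fibrewise
independence on a dense set into independence over functions. -/
lemma eq_zero_of_dense {D U : Set M} (hD : Dense D) (hU : IsOpen U) {f : M → ℝ}
    (hf : ContinuousOn f U) (h : ∀ y ∈ D, y ∈ U → f y = 0) {x : M} (hx : x ∈ U) : f x = 0 := by
  by_contra hne
  obtain ⟨y, ⟨hyU, hy⟩, hyD⟩ := mem_closure_iff_nhds.1 (hD x) _
    (Filter.inter_mem (hU.mem_nhds hx) ((hf.continuousAt (hU.mem_nhds hx)).eventually_ne hne))
  exact hy (h y hyD hyU)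

/-- If `Λ^♯` is injective on a dense set then its image is an almost regular foliation. -/
lemma isAlmostRegularFoliation_symplecticFoliation {Λ : BivectorField I M} (hΛ : IsPoisson Λ)
    {D : Set M} (hD : Dense D) (hinj : ∀ x ∈ D, Function.Injective (Λ.sharp x)) :
    IsAlmostRegularFoliation I (symplecticFoliation Λ) where
  zero_mem := ⟨0, by ext x; exact map_zero (Λ.sharp x)⟩
  add_mem := by
    rintro _ ⟨α, rfl⟩ _ ⟨β, rfl⟩
    exact ⟨α + β, sharp_add Λ α β⟩
  smul_mem := by
    rintro f _ ⟨α, rfl⟩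
    exact ⟨funSMul I f α, sharp_funSMul Λ α f⟩
  lie_mem := by
    rintro _ ⟨α, rfl⟩ _ ⟨β, rfl⟩
    obtain ⟨γ, hγ⟩ := exists_sharp_eq_lie hΛ α β
    exact ⟨_, ⟨γ, rfl⟩, fun x => congrArg (fun Z : VField I M => Z x) hγ⟩
  locally_free := by
    -- The generators are the images of a local coframe, so the rank is the dimension of `M`.
    refine ⟨finrank ℝ (E₀ →L[ℝ] ℝ), fun p => ?_⟩
    obtain ⟨U, hU, hpU, b, hb, hli⟩ := exists_frame I (E₀ →L[ℝ] ℝ)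
      (V := fun x : M => TangentSpace I x →L[ℝ] ℝ) p
    refine ⟨U, hU, hpU, fun i => Λ.sharp.onSec I (b i), fun i => ⟨b i, rfl⟩, ?_, ?_⟩
    · rintro _ ⟨α, rfl⟩
      obtain ⟨c, hc, h⟩ := hb α
      refine ⟨c, hc, fun x hx => ?_⟩
      simp only [BundleMap.onSec_apply, h x hx, map_sum, map_smul]
    · intro f hf h i x hx
      refine eq_zero_of_dense hD hU (hf i).continuousOn (fun y hyD hyU => ?_) hx
      refine Fintype.linearIndependent_iff.1 (hli y hyU) (fun i => f i y) ?_ i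
      apply hinj y hyD
      rw [map_zero, ← h y hyU]
      simp only [BundleMap.onSec_apply, map_sum, map_smul]

end AlmostRegular

/-! ### Tensoriality of the algebroid differential; injectivity of the anchor on sections. -/

section ClosedForms

variable {E₀ : Type*} [NormedAddCommGroup E₀] [NormedSpace ℝ E₀] [FiniteDimensional ℝ E₀]
  {H : Type*} [TopologicalSpace H] {I : ModelWithCorners ℝ E₀ H}
  {M : Type*} [TopologicalSpace M] [ChartedSpace H M] [IsManifold I ∞ M] [T2Space M]
  {F : Type*} [NormedAddCommGroup F] [NormedSpace ℝ F] [FiniteDimensional ℝ F]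
  {V : M → Type*} [TopologicalSpace (TotalSpace F V)]
  [∀ x, AddCommGroup (V x)] [∀ x, Module ℝ (V x)] [∀ x, TopologicalSpace (V x)]
  [FiberBundle F V] [VectorBundle ℝ F V] [ContMDiffVectorBundle ∞ F V I]
  (A : LieAlgebroid I F V) (η : TwoForm I F V)

lemma TwoForm.eval_skew (a b : Sec I F V) : η.eval a b = - η.eval b a := by
  ext x; exact η.skew x (a x) (b x)

lemma TwoForm.eval_add_left (a b c : Sec I F V) : η.eval (a + b) c = η.eval a c + η.eval b c := by
  ext x; exact congrArg (fun α : V x →L[ℝ] ℝ => α (c x)) (map_add (η.form x) (a x) (b x))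

lemma TwoForm.eval_funSMul_left (a c : Sec I F V) (f : C^∞⟮I, M; ℝ⟯) :
    η.eval (funSMul I f a) c = f * η.eval a c := by
  ext x; exact congrArg (fun α : V x →L[ℝ] ℝ => α (c x)) (map_smul (η.form x) (f x) (a x))

lemma TwoForm.eval_neg_left (a c : Sec I F V) : η.eval (-a) c = - η.eval a c := by
  ext x; exact congrArg (fun α : V x →L[ℝ] ℝ => α (c x)) (map_neg (η.form x) (a x))

lemma LieAlgebroid.add_act (a b : Sec I F V) (f : C^∞⟮I, M; ℝ⟯) :
    A.act (a + b) f = A.act a f + A.act b f := by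
  ext x; simp [A.act_apply]

lemma LieAlgebroid.funSMul_act (a : Sec I F V) (f g : C^∞⟮I, M; ℝ⟯) :
    A.act (funSMul I g a) f = g * A.act a f := by
  ext x; simp [A.act_apply]

lemma LieAlgebroid.act_add (a : Sec I F V) (f g : C^∞⟮I, M; ℝ⟯) :
    A.act a (f + g) = A.act a f + A.act a g := VField.act_map_add _ _ _

lemma LieAlgebroid.act_neg (a : Sec I F V) (f : C^∞⟮I, M; ℝ⟯) :
    A.act a (-f) = - A.act a f := VField.act_map_neg _ _

lemma LieAlgebroid.act_mul (a : Sec I F V) (f g : C^∞⟮I, M; ℝ⟯) :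
    A.act a (f * g) = f * A.act a g + g * A.act a f := VField.act_map_mul _ _ _

lemma LieAlgebroid.bracket_funSMul_left (a b : Sec I F V) (f : C^∞⟮I, M; ℝ⟯) :
    A.bracket (funSMul I f a) b = - funSMul I (A.act b f) a + funSMul I f (A.bracket a b) := by
  rw [A.bracket_skew, A.bracket_funSMul, A.bracket_skew a b]
  ext x
  simp [add_comm]

/-- The algebroid differential of a two-form, with values in smooth functions. -/
noncomputable def LieAlgebroid.dTwoMap (a b c : Sec I F V) : C^∞⟮I, M; ℝ⟯ :=
  A.act a (η.eval b c) - A.act b (η.eval a c) + A.act c (η.eval a b)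
    - η.eval (A.bracket a b) c + η.eval (A.bracket a c) b - η.eval (A.bracket b c) a

lemma LieAlgebroid.dTwoMap_apply (a b c : Sec I F V) (x : M) :
    A.dTwoMap η a b c x = A.dTwo η a b c x := rfl

lemma LieAlgebroid.dTwoMap_add (a a' b c : Sec I F V) :
    A.dTwoMap η (a + a') b c = A.dTwoMap η a b c + A.dTwoMap η a' b c := by
  simp only [dTwoMap, A.add_act, A.act_add, η.eval_add_left, A.bracket_add_left,
    η.eval_skew _ (a + a'), η.eval_skew _ a, η.eval_skew _ a']
  ring

/-- The derivatives of `f` along `b` and `c` from the Cartan terms cancel those produced by the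
Leibniz rule. -/
lemma LieAlgebroid.dTwoMap_funSMul (a b c : Sec I F V) (f : C^∞⟮I, M; ℝ⟯) :
    A.dTwoMap η (funSMul I f a) b c = f * A.dTwoMap η a b c := by
  simp only [dTwoMap, A.funSMul_act, A.act_mul, η.eval_add_left, η.eval_neg_left,
    η.eval_funSMul_left, A.bracket_funSMul_left, η.eval_skew _ (funSMul I f a)]
  rw [η.eval_skew (A.bracket b c) a]
  ring

/-- Cyclic symmetry carries tensoriality from the first slot to the other two. -/
lemma LieAlgebroid.dTwoMap_rotate (a b c : Sec I F V) :
    A.dTwoMap η a b c = A.dTwoMap η b c a := by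
  simp only [dTwoMap]
  rw [η.eval_skew b a, η.eval_skew c a, A.bracket_skew b a, A.bracket_skew c a,
    η.eval_neg_left, η.eval_neg_left, A.act_neg, A.act_neg]
  ring

lemma LieAlgebroid.dTwoMap_congr_left {a a' : Sec I F V} (b c : Sec I F V) {x : M}
    (h : a x = a' x) : A.dTwoMap η a b c x = A.dTwoMap η a' b c x := by
  refine tensorial_congr (T := fun a => A.dTwoMap η a b c x) (fun s t => ?_) (fun f s => ?_) h
  · simp [A.dTwoMap_add]
  · simp [A.dTwoMap_funSMul]

lemma LieAlgebroid.dTwoMap_congr {a a' b b' c c' : Sec I F V} {x : M}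
    (ha : a x = a' x) (hb : b x = b' x) (hc : c x = c' x) :
    A.dTwoMap η a b c x = A.dTwoMap η a' b' c' x := by
  rw [A.dTwoMap_congr_left η b c ha, A.dTwoMap_rotate, A.dTwoMap_congr_left η c a' hb,
    A.dTwoMap_rotate, A.dTwoMap_congr_left η a' b' hc, A.dTwoMap_rotate]

variable {A} in
/-- The anchor of an almost injective algebroid is injective on sections. -/
lemma LieAlgebroid.IsAlmostInjective.onSec_injective (hA : A.IsAlmostInjective) {a b : Sec I F V}
    (h : A.anchor.onSec I a = A.anchor.onSec I b) : a = b := by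
  obtain ⟨D, -, hD, hinj⟩ := hA
  ext x
  obtain ⟨U, hU, hxU, e, he, hli⟩ := exists_frame I F (V := V) x
  obtain ⟨c, hc, hs⟩ := he (a - b)
  -- The frame coefficients of `a - b` vanish over the dense set where the anchor is injective,
  -- hence everywhere by continuity.
  have hc0 : ∀ i, c i x = 0 := fun i => by
    refine eq_zero_of_dense hD hU (hc i).continuousOn (fun y hyD hyU => ?_) hxU
    refine Fintype.linearIndependent_iff.1 (hli y hyU) (fun i => c i y) ?_ i
    rw [← hs y hyU, ContMDiffSection.coe_sub, Pi.sub_apply, sub_eq_zero]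
    exact hinj y hyD (congrArg (fun Z : VField I M => Z y) h)
  have := hs x hxU
  simpa [hc0, sub_eq_zero] using this

end ClosedForms

/-! ### From an almost regular Poisson structure to a closed form. -/

section PoissonToForm

variable {E₀ : Type*} [NormedAddCommGroup E₀] [NormedSpace ℝ E₀] [FiniteDimensional ℝ E₀]
  {H : Type*} [TopologicalSpace H] {I : ModelWithCorners ℝ E₀ H}
  {M : Type*} [TopologicalSpace M] [ChartedSpace H M] [IsManifold I ∞ M] [T2Space M]
  {F : Type*} [NormedAddCommGroup F] [NormedSpace ℝ F] [FiniteDimensional ℝ F]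
  {V : M → Type*} [TopologicalSpace (TotalSpace F V)]
  [∀ x, AddCommGroup (V x)] [∀ x, Module ℝ (V x)] [∀ x, TopologicalSpace (V x)]
  [∀ x, IsTopologicalAddGroup (V x)] [∀ x, ContinuousSMul ℝ (V x)]
  [FiberBundle F V] [VectorBundle ℝ F V] [ContMDiffVectorBundle ∞ F V I]
  {A : LieAlgebroid I F V} {Λ : BivectorField I M}
  {l : BundleMap I (E₀ →L[ℝ] ℝ) (fun x : M => TangentSpace I x →L[ℝ] ℝ) F V}

lemma BundleMap.onSec_add (l : BundleMap I (E₀ →L[ℝ] ℝ)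
    (fun x : M => TangentSpace I x →L[ℝ] ℝ) F V) (α β : OneForm I M) :
    l.onSec I (α + β) = l.onSec I α + l.onSec I β := by
  ext x; exact map_add (l x) (α x) (β x)

lemma BundleMap.onSec_funSMul (l : BundleMap I (E₀ →L[ℝ] ℝ)
    (fun x : M => TangentSpace I x →L[ℝ] ℝ) F V) (f : C^∞⟮I, M; ℝ⟯) (α : OneForm I M) :
    l.onSec I (funSMul I f α) = funSMul I f (l.onSec I α) := by
  ext x; exact map_smul (l x) (f x) (α x)

lemma LieAlgebroid.anchor_onSec_add (a b : Sec I F V) :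
    A.anchor.onSec I (a + b) = A.anchor.onSec I a + A.anchor.onSec I b := by
  ext x; exact map_add (A.anchor x) (a x) (b x)

lemma LieAlgebroid.anchor_onSec_funSMul (f : C^∞⟮I, M; ℝ⟯) (a : Sec I F V) :
    A.anchor.onSec I (funSMul I f a) = funSMul I f (A.anchor.onSec I a) := by
  ext x; exact map_smul (A.anchor x) (f x) (a x)

/-- `l` lifts `Λ^♯` through the anchor of `A`. -/
def IsSharpLift (A : LieAlgebroid I F V) (Λ : BivectorField I M)
    (l : BundleMap I (E₀ →L[ℝ] ℝ) (fun x : M => TangentSpace I x →L[ℝ] ℝ) F V) : Prop :=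
  ∀ (x : M) (α : TangentSpace I x →L[ℝ] ℝ), A.anchor x (l x α) = Λ.sharp x α

lemma IsSharpLift.anchor_onSec (hl : IsSharpLift A Λ l) (α : OneForm I M) :
    A.anchor.onSec I (l.onSec I α) = Λ.sharp.onSec I α := by
  ext x; exact hl x (α x)

/-- Each `Λ^♯ α` lies in the image of the anchor on sections; uniqueness of the lift forces
linearity over functions. -/
lemma exists_isSharpLift (hA : A.IsAiAlgebroidOf (symplecticFoliation Λ)) :
    ∃ l, IsSharpLift A Λ l := by
  have hex : ∀ α : OneForm I M, ∃ a, A.anchor.onSec I a = Λ.sharp.onSec I α := by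
    intro α
    have : Λ.sharp.onSec I α ∈ A.foliation := by rw [hA.2]; exact ⟨α, rfl⟩
    exact this
  choose Φ hΦ using hex
  obtain ⟨l, hl⟩ := exists_bundleMap_of_linear (V := fun x : M => TangentSpace I x →L[ℝ] ℝ) Φ
    (fun α β => hA.1.onSec_injective (by
      rw [A.anchor_onSec_add, hΦ, hΦ, hΦ, sharp_add]))
    (fun f α => hA.1.onSec_injective (by
      rw [A.anchor_onSec_funSMul, hΦ, hΦ, sharp_funSMul]))
  refine ⟨l, fun x α => ?_⟩
  obtain ⟨σ, rfl⟩ := exists_sec_apply_eq I (E₀ →L[ℝ] ℝ)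
    (V := fun x : M => TangentSpace I x →L[ℝ] ℝ) α
  rw [hl]
  exact congrArg (fun Z : VField I M => Z x) (hΦ σ)

lemma IsSharpLift.unique (hA : A.IsAlmostInjective)
    {l' : BundleMap I (E₀ →L[ℝ] ℝ) (fun x : M => TangentSpace I x →L[ℝ] ℝ) F V}
    (hl : IsSharpLift A Λ l) (hl' : IsSharpLift A Λ l') : l = l' := by
  refine BundleMap.ext_of_sec (V := fun x : M => TangentSpace I x →L[ℝ] ℝ) fun s x => ?_
  have : l.onSec I s = l'.onSec I s := hA.onSec_injective (by
    rw [hl.anchor_onSec, hl'.anchor_onSec])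
  exact congrArg (fun t : Sec I F V => t x) this

/-- The anchor image of `a` is also some `Λ^♯ α`, and the anchor cancels on sections. Surjectivity
on fibres follows even where the anchor is not injective. -/
lemma IsSharpLift.onSec_surjective (hA : A.IsAiAlgebroidOf (symplecticFoliation Λ))
    (hl : IsSharpLift A Λ l) (a : Sec I F V) : ∃ α, l.onSec I α = a := by
  have : A.anchor.onSec I a ∈ symplecticFoliation Λ := by rw [← hA.2]; exact ⟨a, rfl⟩
  obtain ⟨α, hα⟩ := this
  exact ⟨α, hA.1.onSec_injective (by rw [hl.anchor_onSec]; exact hα)⟩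

lemma IsSharpLift.surjective (hA : A.IsAiAlgebroidOf (symplecticFoliation Λ))
    (hl : IsSharpLift A Λ l) (x : M) : Function.Surjective (l x) := by
  intro v
  obtain ⟨a, rfl⟩ := exists_sec_apply_eq I F v
  obtain ⟨α, rfl⟩ := hl.onSec_surjective hA a
  exact ⟨α x, rfl⟩

/-- The form must satisfy `η(a, l β) = β(ρ a)`. For `a = l α` this covector is `-ρ^* α`, by skewness
of `Λ`. As the `l β` fill the fibre, the chosen preimage `α` is irrelevant, yet it shows that the
covector field is smooth. -/
lemma IsSharpLift.exists_twoForm (hA : A.IsAiAlgebroidOf (symplecticFoliation Λ))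
    (hl : IsSharpLift A Λ l) : ∃ η : TwoForm I F V,
      ∀ (x : M) (α β : TangentSpace I x →L[ℝ] ℝ), η.form x (l x α) (l x β) = β (Λ.sharp x α) := by
  choose Ψ hΨ using hl.onSec_surjective hA
  have hsurj := hl.surjective hA
  have key : ∀ (a : Sec I F V) (x : M) (β : TangentSpace I x →L[ℝ] ℝ),
      (-(A.anchor.pullSec (Ψ a))) x (l x β) = β (A.anchor x (a x)) := by
    intro a x β
    have h1 : l x (Ψ a x) = a x := congrArg (fun t : Sec I F V => t x) (hΨ a)
    change -(Ψ a x (A.anchor x (l x β))) = _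
    rw [hl, Λ.skew x β, neg_neg, ← h1, hl]
  obtain ⟨L, hL⟩ := exists_bundleMap_of_linear (I := I) (W := fun x : M => V x →L[ℝ] ℝ)
    (fun a : Sec I F V => -(A.anchor.pullSec (Ψ a)))
    (fun a b => by
      ext x w
      obtain ⟨β, rfl⟩ := hsurj x w
      rw [key]
      refine Eq.trans ?_ (congrArg₂ (· + ·) (key a x β) (key b x β)).symm
      simp)
    (fun f a => by
      ext x w
      obtain ⟨β, rfl⟩ := hsurj x w
      rw [key]
      refine Eq.trans ?_ (congrArg (fun t => f x • t) (key a x β)).symm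
      simp)
  have hL' : ∀ (x : M) (v : V x) (β : TangentSpace I x →L[ℝ] ℝ),
      L x v (l x β) = β (A.anchor x v) := by
    intro x v β
    obtain ⟨a, rfl⟩ := exists_sec_apply_eq I F v
    rw [hL, key]
  refine ⟨⟨L, fun x v => ?_⟩, fun x α β => ?_⟩
  · obtain ⟨β, rfl⟩ := hsurj x v
    rw [hL', hl, Λ.alternating]
  · change L x (l x α) (l x β) = _
    rw [hL', hl]

lemma TwoForm.eq_of_surjective (hs : ∀ x, Function.Surjective (l x)) {η η' : TwoForm I F V}
    (h : ∀ (x : M) (α β : TangentSpace I x →L[ℝ] ℝ),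
      η.form x (l x α) (l x β) = η'.form x (l x α) (l x β)) : η = η' := by
  have : η.form = η'.form := by
    ext x v w
    obtain ⟨α, rfl⟩ := hs x v
    obtain ⟨β, rfl⟩ := hs x w
    exact h x α β
  cases η; cases η'; congr

/-- After applying the anchor both sides are the Hamiltonian field of the bracket, by Jacobi; then
the anchor cancels on sections. -/
lemma IsSharpLift.bracket_dForm (hA : A.IsAlmostInjective) (hΛ : IsPoisson Λ)
    (hl : IsSharpLift A Λ l) (f g : C^∞⟮I, M; ℝ⟯) :
    A.bracket (l.onSec I (dForm f)) (l.onSec I (dForm g)) = l.onSec I (dForm (poisson Λ f g)) := by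
  refine hA.onSec_injective (VField.ext_act fun h => ?_)
  have hact : ∀ u v, A.act (l.onSec I (dForm u)) v = VField.act (hamiltonian Λ u) v := fun u v =>
    congrArg (fun Z => VField.act Z v) (hl.anchor_onSec (dForm u))
  rw [hl.anchor_onSec]
  change A.act _ h = VField.act (hamiltonian Λ (poisson Λ f g)) h
  rw [A.act_bracket, hamiltonian_poisson hΛ]
  simp only [hact]

lemma IsSharpLift.isClosedForm (hA : A.IsAiAlgebroidOf (symplecticFoliation Λ))
    (hΛ : IsPoisson Λ) (hl : IsSharpLift A Λ l) {η : TwoForm I F V}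
    (hη : ∀ (x : M) (α β : TangentSpace I x →L[ℝ] ℝ),
      η.form x (l x α) (l x β) = β (Λ.sharp x α)) : A.IsClosedForm η := by
  intro a b c x
  -- Surjectivity of `l`, with every covector at `x` a differential, reduces the closedness test to
  -- Hamiltonian sections.
  have hex : ∀ v : V x, ∃ f : C^∞⟮I, M; ℝ⟯, v = l.onSec I (dForm f) x := by
    intro v
    obtain ⟨α, rfl⟩ := hl.surjective hA x v
    obtain ⟨f, rfl⟩ := exists_mvfderiv_eq α
    exact ⟨f, rfl⟩
  obtain ⟨f, hf⟩ := hex (a x)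
  obtain ⟨g, hg⟩ := hex (b x)
  obtain ⟨h, hh⟩ := hex (c x)
  rw [← A.dTwoMap_apply, A.dTwoMap_congr η hf hg hh]
  have hact : ∀ u v, A.act (l.onSec I (dForm u)) v = poisson Λ u v := fun u v =>
    congrArg (fun Z => VField.act Z v) (hl.anchor_onSec (dForm u))
  have heval : ∀ u v, η.eval (l.onSec I (dForm u)) (l.onSec I (dForm v)) = poisson Λ u v := by
    intro u v
    ext y
    exact hη y _ _
  have hJ := (isPoisson_iff Λ).1 hΛ f g h
  have e1 : ∀ a b : C^∞⟮I, M; ℝ⟯, poisson Λ a (-b) = - poisson Λ a b := fun a b =>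
    VField.act_map_neg _ _
  -- Here derivative terms and bracket terms each give the Jacobiator once, hence the factor 2.
  have : A.dTwoMap η (l.onSec I (dForm f)) (l.onSec I (dForm g)) (l.onSec I (dForm h)) = 0 := by
    simp only [LieAlgebroid.dTwoMap, hl.bracket_dForm hA.1 hΛ, hact, heval]
    rw [poisson_skew Λ (poisson Λ f g) h, poisson_skew Λ (poisson Λ f h) g,
      poisson_skew Λ (poisson Λ g h) f, poisson_skew Λ f h, e1]
    linear_combination 2 * hJ
  rw [this]
  rfl

/-- If `l α` is in the kernel of `η`, every covector kills `Λ^♯ α = ρ(l α)`, and injectivity of `ρ`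
at `x` gives `l α = 0`. -/
lemma IsSharpLift.nondegenerateAt (hs : ∀ x, Function.Surjective (l x))
    (hl : IsSharpLift A Λ l) {η : TwoForm I F V}
    (hη : ∀ (x : M) (α β : TangentSpace I x →L[ℝ] ℝ),
      η.form x (l x α) (l x β) = β (Λ.sharp x α)) {x : M}
    (hx : Function.Injective (A.anchor x)) : η.NondegenerateAt x := by
  intro v hv
  obtain ⟨α, rfl⟩ := hs x v
  apply hx
  rw [hl, map_zero]
  refine tangent_ext fun f => ?_
  rw [← hη, hv, map_zero]

lemma IsSharpLift.bijective (hs : ∀ x, Function.Surjective (l x)) (hr : A.IsFullRank) (x : M) :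
    Function.Bijective (l x) := by
  have := (fiberEquiv F (V := V) x).symm.toLinearEquiv.finiteDimensional
  have := (fiberEquiv (E₀ →L[ℝ] ℝ)
    (V := fun x : M => TangentSpace I x →L[ℝ] ℝ) x).symm.toLinearEquiv.finiteDimensional
  refine ⟨(LinearMap.injective_iff_surjective_of_finrank_eq_finrank
    (f := (l x : (TangentSpace I x →L[ℝ] ℝ) →ₗ[ℝ] V x)) ?_).2 (hs x), hs x⟩
  rw [finrank_fiber F, finrank_fiber (E₀ →L[ℝ] ℝ) (V := fun x : M => TangentSpace I x →L[ℝ] ℝ),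
    finrank_strongDual]
  exact hr.symm

/-- The bracket of `A` is transported along `l`; each axiom is checked after applying `l`, and the
anchor is right because `ρ ∘ l = Λ^♯`. -/
lemma IsSharpLift.exists_cotangentAlgebroid (hA : A.IsAlmostInjective) (hΛ : IsPoisson Λ)
    (hl : IsSharpLift A Λ l) (hb : ∀ x, Function.Bijective (l x)) :
    ∃ B : LieAlgebroid I (E₀ →L[ℝ] ℝ) (fun x : M => TangentSpace I x →L[ℝ] ℝ),
      IsCotangentAlgebroid Λ B ∧ ∀ α β : OneForm I M,
        l.onSec I (B.bracket α β) = A.bracket (l.onSec I α) (l.onSec I β) := by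
  obtain ⟨K, hK1, hK2⟩ := BundleMap.exists_inverse
    (V := fun x : M => TangentSpace I x →L[ℝ] ℝ) l hb
  have hlK : ∀ a : Sec I F V, l.onSec I (K.onSec I a) = a := fun a => by
    ext x; exact hK2 x (a x)
  have hKl : ∀ α : OneForm I M, K.onSec I (l.onSec I α) = α := fun α => by
    ext x : 1; exact hK1 x (α x)
  have hinj : ∀ {α β : OneForm I M}, l.onSec I α = l.onSec I β → α = β := fun {α β} h => by
    rw [← hKl α, h, hKl]
  have hl0 : l.onSec I 0 = 0 := by ext x; exact map_zero (l x)
  let br : OneForm I M → OneForm I M → OneForm I M := fun α β =>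
    K.onSec I (A.bracket (l.onSec I α) (l.onSec I β))
  have hbr : ∀ α β, l.onSec I (br α β) = A.bracket (l.onSec I α) (l.onSec I β) := fun α β => hlK _
  refine ⟨{ anchor := Λ.sharp
            bracket := br
            bracket_self := fun a => hinj (by rw [hbr, A.bracket_self, hl0])
            bracket_add_left := fun a b c => hinj (by
              simp only [hbr, l.onSec_add, A.bracket_add_left])
            bracket_add_right := fun a b c => hinj (by
              simp only [hbr, l.onSec_add, A.bracket_add_right])
            jacobi := fun a b c => hinj (by
              simp only [hbr, l.onSec_add, A.jacobi, hl0])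
            leibniz := fun a b f x => ?_ }, ⟨rfl, fun f g α β hα hβ x => ?_⟩, hbr⟩
  · apply (hb x).1
    have h := A.leibniz (l.onSec I a) (l.onSec I b) f x
    rw [← l.onSec_funSMul, ← hbr, ← hbr] at h
    simp only [BundleMap.onSec_apply] at h
    rw [h, map_add, map_smul, map_smul, hl]
  · obtain rfl : α = dForm f := ContMDiffSection.ext hα
    obtain rfl : β = dForm g := ContMDiffSection.ext hβ
    have : br (dForm f) (dForm g) = dForm (poisson Λ f g) := hinj (by
      rw [hbr, hl.bracket_dForm hA hΛ])
    exact congrArg (fun γ : OneForm I M => γ x) this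

end PoissonToForm

/-! ### Injectivity of `Λ^♯` in full rank. -/

section FullRank

variable {E₀ : Type*} [NormedAddCommGroup E₀] [NormedSpace ℝ E₀] [FiniteDimensional ℝ E₀]
  {H : Type*} [TopologicalSpace H] {I : ModelWithCorners ℝ E₀ H}
  {M : Type*} [TopologicalSpace M] [ChartedSpace H M] [IsManifold I ∞ M] [T2Space M]
  {F : Type*} [NormedAddCommGroup F] [NormedSpace ℝ F] [FiniteDimensional ℝ F]
  {V : M → Type*} [TopologicalSpace (TotalSpace F V)]
  [∀ x, AddCommGroup (V x)] [∀ x, Module ℝ (V x)] [∀ x, TopologicalSpace (V x)]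
  [∀ x, IsTopologicalAddGroup (V x)] [∀ x, ContinuousSMul ℝ (V x)]
  [FiberBundle F V] [VectorBundle ℝ F V] [ContMDiffVectorBundle ∞ F V I]
  {A : LieAlgebroid I F V}

/-- Equal dimensions make the anchor bijective at `x`, so its transpose is injective; `P^♯` is
injective as `-η^♭` inverts it. `Λ^♯` is the composite of these. -/
lemma sharp_injective_of_isFullRank (hr : A.IsFullRank) {η : TwoForm I F V} {P : Bivector I F V}
    (hP : IsDualBivector η P) {Λ : BivectorField I M}
    (hΛ : ∀ (x : M) (α : TangentSpace I x →L[ℝ] ℝ),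
      Λ.sharp x α = A.anchor x (P.sharp x (α.comp (A.anchor x))))
    {x : M} (hx : Function.Injective (A.anchor x)) : Function.Injective (Λ.sharp x) := by
  have := (fiberEquiv F (V := V) x).symm.toLinearEquiv.finiteDimensional
  have : FiniteDimensional ℝ (TangentSpace I x) := inferInstanceAs (FiniteDimensional ℝ E₀)
  have hsurj : Function.Surjective (A.anchor x) :=
    (LinearMap.injective_iff_surjective_of_finrank_eq_finrank
      (f := (A.anchor x : V x →ₗ[ℝ] TangentSpace I x))
      ((finrank_fiber F x).trans hr)).1 hx
  intro α β h
  rw [hΛ, hΛ] at h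
  have h1 := congrArg (η.form x) (hx h)
  rw [(hP x).2, (hP x).2, neg_inj] at h1
  ext v
  obtain ⟨w, rfl⟩ := hsurj v
  exact congrArg (fun γ : V x →L[ℝ] ℝ => γ w) h1

end FullRank

end EStruct

/-! ### Assembly of the two directions. -/

open EStruct in
theorem theoremA
    {E₀ : Type*} [NormedAddCommGroup E₀] [NormedSpace ℝ E₀] [FiniteDimensional ℝ E₀]
    {H : Type*} [TopologicalSpace H] (I : ModelWithCorners ℝ E₀ H) [I.Boundaryless]
    (M : Type*) [TopologicalSpace M] [ChartedSpace H M] [IsManifold I ∞ M]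
    [T2Space M] [SecondCountableTopology M]
    (F : Type*) [NormedAddCommGroup F] [NormedSpace ℝ F] [FiniteDimensional ℝ F]
    (V : M → Type*) [TopologicalSpace (TotalSpace F V)]
    [∀ x, AddCommGroup (V x)] [∀ x, Module ℝ (V x)] [∀ x, TopologicalSpace (V x)]
    [∀ x, IsTopologicalAddGroup (V x)] [∀ x, ContinuousSMul ℝ (V x)]
    [FiberBundle F V] [VectorBundle ℝ F V] [ContMDiffVectorBundle ∞ F V I]
    (A : LieAlgebroid I F V) :
    -- (1) from an `E`-symplectic form to a Poisson structure
    (∀ E : Set (VField I M), IsAlmostRegularFoliation I E → A.IsAiAlgebroidOf E →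
      ∀ η : TwoForm I F V, A.IsSymplecticForm η →
        (∃! P : Bivector I F V, IsDualBivector η P) ∧
        ∀ P : Bivector I F V, IsDualBivector η P →
          ∃ Λ : BivectorField I M,
            (∀ (x : M) (α : TangentSpace I x →L[ℝ] ℝ),
              Λ.sharp x α = A.anchor x (P.sharp x (α.comp (A.anchor x)))) ∧
            IsPoisson Λ ∧
            (A.IsFullRank → IsAlmostRegularPoisson Λ)) ∧
    -- (2) from an almost regular Poisson structure to a closed `E`-form of degree two
    (∀ Λ : BivectorField I M, IsAlmostRegularPoisson Λ →
      A.IsAiAlgebroidOf (symplecticFoliation Λ) →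
        (∃! l : BundleMap I (E₀ →L[ℝ] ℝ) (fun x : M => TangentSpace I x →L[ℝ] ℝ) F V,
          ∀ (x : M) (α : TangentSpace I x →L[ℝ] ℝ), A.anchor x (l x α) = Λ.sharp x α) ∧
        ∀ l : BundleMap I (E₀ →L[ℝ] ℝ) (fun x : M => TangentSpace I x →L[ℝ] ℝ) F V,
          (∀ (x : M) (α : TangentSpace I x →L[ℝ] ℝ), A.anchor x (l x α) = Λ.sharp x α) →
          (∀ x, Function.Surjective (l x)) ∧
          (∃! η : TwoForm I F V, ∀ (x : M) (α β : TangentSpace I x →L[ℝ] ℝ),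
            η.form x (l x α) (l x β) = β (Λ.sharp x α)) ∧
          (∀ η : TwoForm I F V,
            (∀ (x : M) (α β : TangentSpace I x →L[ℝ] ℝ),
              η.form x (l x α) (l x β) = β (Λ.sharp x α)) →
            A.IsClosedForm η ∧
            ∃ U : Set M, IsOpen U ∧ Dense U ∧ ∀ x ∈ U, η.NondegenerateAt x) ∧
          (A.IsFullRank →
            (∀ x, Function.Bijective (l x)) ∧
            ∃ B : LieAlgebroid I (E₀ →L[ℝ] ℝ) (fun x : M => TangentSpace I x →L[ℝ] ℝ),
              IsCotangentAlgebroid Λ B ∧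
              ∀ α β : OneForm I M,
                l.onSec I (B.bracket α β) = A.bracket (l.onSec I α) (l.onSec I β))) := by

  refine ⟨fun E _ hAE η hη => ⟨?_, fun P hP => ?_⟩, fun Λ hΛ hA => ⟨?_, fun l hl => ?_⟩⟩
  · obtain ⟨P, hP⟩ := exists_isDualBivector η hη.2
    exact ⟨P, hP, fun Q hQ => hQ.ext hP⟩
  · obtain ⟨Λ, hΛ⟩ := exists_pushforward_bivector P A
    have hPois := isPoisson_of_isClosedForm hη.1 hP hΛ
    refine ⟨Λ, hΛ, hPois, fun hr => ⟨hPois, ?_⟩⟩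
    obtain ⟨D, -, hD, hinj⟩ := hAE.1
    exact isAlmostRegularFoliation_symplecticFoliation hPois hD fun x hx =>
      sharp_injective_of_isFullRank hr hP hΛ (hinj x hx)
  · obtain ⟨l, hl⟩ := exists_isSharpLift hA
    exact ⟨l, hl, fun l' hl' => IsSharpLift.unique hA.1 hl' hl⟩
  · have hl : IsSharpLift A Λ l := hl
    have hs := hl.surjective hA
    refine ⟨hs, ?_, fun η hη => ⟨hl.isClosedForm hA hΛ.1 hη, ?_⟩, fun hr => ?_⟩
    · obtain ⟨η, hη⟩ := hl.exists_twoForm hA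
      exact ⟨η, hη, fun η' hη' => TwoForm.eq_of_surjective hs fun x α β => by rw [hη', hη]⟩
    · obtain ⟨D, hDo, hD, hinj⟩ := hA.1
      exact ⟨D, hDo, hD, fun x hx => hl.nondegenerateAt hs hη (hinj x hx)⟩
    · have hb := IsSharpLift.bijective hs hr
      exact ⟨hb, hl.exists_cotangentAlgebroid hA.1 hΛ.1 hb⟩
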